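/- Let $A$ be a finite abelian group, written multiplicatively. Let $\psi_A\colon \mathbb{Z}A\to A$ be the homomorphism $\psi_A\big(\sum_{a} k_a a\big)=\prod_{a} a^{k_a}$ from the additive group of the group ring to $A$, let $\Delta A=\{\sum_a k_a a\in\mathbb{Z}A : \sum_a k_a=0\}$ be the augmentation ideal, and let $$L(A):=\ker(\psi_A)\cap \Delta A ,$$ considered as a lattice in the Euclidean space $\mathbb{R}A$ with scalar product $\langle \sum_a x_a a,\sum_a y_a a\rangle=\sum_a x_a y_a$. The packing density of a full-rank lattice $\Lambda$ in a finite-dimensional Euclidean space $U$ is $$\delta(\Lambda)=\frac{\operatorname{vol}\big(B(0,\tfrac12 \min\{\|x\| : 0\ne x\in\Lambda\})\big)}{\operatorname{vol}(U/\Lambda)},$$ where $B(0,r)$ is the ball of radius $r$ around $0$. A lattice $\Lambda$ with real span $U$ is called extreme if $\delta$ has a local maximum at $\Lambda$ among the full-rank lattices in $U$, that is, there is $\varepsilon>0$ such that $\delta(g\Lambda)\le\delta(\Lambda)$ for all $g\in GL(U)$ with $\|g-\mathrm{id}_U\|<\varepsilon$ (operator norm). **Corollary.** If $|A|\ge 7$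 and $A$ is not isomorphic to $C_4\times C_2$, then $L(A)$ is extreme. -/

import Mathlib

open MeasureTheory

noncomputable section

namespace AbelianLattice

section GroupLattice

variable (A : Type*) [CommGroup A]

/-- The augmentation map (coefficient sum) of the integral group ring. -/
def augmentation : MonoidAlgebra ℤ A →+* ℤ :=
  (MonoidAlgebra.lift ℤ ℤ A (1 : A →* ℤ)).toRingHom

/-- The augmentation ideal `Δ A`. -/
def augmentationIdeal : Ideal (MonoidAlgebra ℤ A) :=
  RingHom.ker (augmentation A)

variable [Fintype A]

theorem augmentation_apply (r : MonoidAlgebra ℤ A) :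
    augmentation A r = ∑ a : A, r.coeff a := by
  simp [augmentation, MonoidAlgebra.lift_apply, Finsupp.sum_fintype]

/-- The exponential type homomorphism `ψ_A (∑ k_a a) = ∏ a ^ k_a`, from the additive group of the
group ring to the (multiplicatively written) group `A`. -/
def psi : MonoidAlgebra ℤ A →+ Additive A where
  toFun r := Additive.ofMul (∏ a : A, a ^ r.coeff a)
  map_zero' := by simp
  map_add' r s := by simp [zpow_add, Finset.prod_mul_distrib]

/-- The lattice of `A` inside the integral group ring: `Ker ψ_A ∩ Δ A`. -/
def latt : AddSubgroup (MonoidAlgebra ℤ A) :=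
  (psi A).ker ⊓ (augmentationIdeal A).toAddSubgroup

/-- The inclusion of `ℤ A` in the Euclidean space `ℝ A`, where `ℝ A` carries the scalar product
`⟨∑ x_a a, ∑ y_a a⟩ = ∑ x_a y_a`. -/
def toEuclidean : MonoidAlgebra ℤ A →+ EuclideanSpace ℝ A where
  toFun r := WithLp.toLp 2 fun a => (r.coeff a : ℝ)
  map_zero' := by ext a; simp
  map_add' r s := by ext a; simp

/-- The lattice of `A` as a subgroup of the Euclidean space `ℝ A`. -/
def lattice : Submodule ℤ (EuclideanSpace ℝ A) :=
  AddSubgroup.toIntSubmodule ((latt A).map (toEuclidean A))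

end GroupLattice

section Density

variable {E : Type*} [NormedAddCommGroup E]

/-- The minimum distance of a lattice: the least length of a nonzero vector. -/
def minDist (L : Submodule ℤ E) : ℝ :=
  sInf {d : ℝ | ∃ x ∈ L, x ≠ 0 ∧ ‖x‖ = d}

variable [InnerProductSpace ℝ E] [FiniteDimensional ℝ E] [MeasurableSpace E] [BorelSpace E]

/-- The density of the packing by balls of radius `minDist L / 2` centred at the points of a
full lattice `L` in the Euclidean space `E`: the volume of one ball divided by the volume of a
fundamental domain of `L`. -/
def packingDensity (L : Submodule ℤ E) : ℝ :=
  (volume : Measure E).real (Metric.ball (0 : E) (minDist L / 2)) /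
    ZLattice.covolume L (volume : Measure E)

end Density

section Extreme

variable {V : Type*} [NormedAddCommGroup V] [InnerProductSpace ℝ V]

/-- A lattice in `V`, considered in its real span, in which it has full rank. -/
def latticeInSpan (L : Submodule ℤ V) : Submodule ℤ (Submodule.span ℝ (L : Set V)) :=
  ZLattice.comap ℝ L (Submodule.span ℝ (L : Set V)).subtype

variable [FiniteDimensional ℝ V] [MeasurableSpace V] [BorelSpace V]

/-- `L` is extreme: it is a (discrete) lattice, and the packing density has a local maximum
at `L` on the space of all full lattices in the real span `U` of `L`. The lattices close to `L` are
the images `g L` under the automorphisms `g` of the vector space `U` that are close to the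
identity. -/
def IsExtreme (L : Submodule ℤ V) : Prop :=
  DiscreteTopology L ∧
    ∃ ε : ℝ, 0 < ε ∧
      ∀ g : Submodule.span ℝ (L : Set V) ≃L[ℝ] Submodule.span ℝ (L : Set V),
        ‖(g : Submodule.span ℝ (L : Set V) →L[ℝ] Submodule.span ℝ (L : Set V)) -
            ContinuousLinearMap.id ℝ (Submodule.span ℝ (L : Set V))‖ < ε →
          packingDensity
              ((latticeInSpan L).map (g.toLinearEquiv.toLinearMap.restrictScalars ℤ)) ≤
            packingDensity (latticeInSpan L)

end Extreme

end AbelianLattice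

end

/-!
For `|A| ≥ 7` the shortest nonzero vectors of `L(A)` have length `2`. They are the vectors
`a + b - c - d` with four different group elements such that `a b = c d`; writing `A` additively,
`a, c, d, b` are the vertices `a, a + x, a + y, a + x + y` of a parallelogram. Extremality follows
Voronoi's argument, with perfection and eutaxy proved at once.

A quadratic form `q` on the span of `L(A)` is determined by `d a b = q (a - b)`, and its value at a
parallelogram vector is the alternating sum `parallelogramDefect d a x y` of the six values of `d`
on the vertices. The central fact, `eq_zero_of_parallelogramDefect_nonneg`, is that a form of trace
zero that is nonnegative on all parallelogram vectors vanishes.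

* Averaging over translations gives an even function `T` on `A` with sum zero that satisfies the
  parallelogram inequality `T (x + y) + T (x - y) ≤ 2 T x + 2 T y` for `x ≠ ± y`. Summing this over
  a nontrivial coset of a proper subgroup containing `x` gives `0 ≤ T x`. So a negative minimum is
  attained at a generator `g` only, and there the sums over all parallelograms with side `g` and
  over those with diagonal `2 g` give incompatible bounds on `T (2 g)`. Hence `T = 0`
  (`eq_zero_of_parallelogram_le`).
* Then all defects vanish, so `d` is flat (`IsFlat`). Summing the defects over all parallelograms
  with a given side gives a three-term relation (`IsFlat.three_term`), which forces `d = 0` at once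
  if `|A| > 10`. Summing over cosets of the multiples of `x` handles those `x` that generate a
  subgroup of index at least three. These two relations and a few single defects settle the groups
  of order at most ten. Of the groups of order eight, only `C₄ × C₂` has elements of order four
  that are not twice an element of order eight, and there the argument breaks down.

By compactness, a form of trace zero takes a value `≤ -c ‖d‖` on some parallelogram vector
(`exists_parallelogramDefect_le`). For `g` near the identity write
`‖g x‖ ^ 2 = s (‖x‖ ^ 2 + h x)` with `h` of trace zero. Then `g` shortens a minimal vector, relative
to `√s`, to first order in `h`, while `det g ^ 2 / s ^ N` differs from `1` to second order only
(`exists_norm_parallelogramVector_pow_le`), so the density does not increase.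
-/

namespace AbelianLattice

/-! ### Functions satisfying the parallelogram inequality -/

section Parallelogram

variable {G : Type*} [AddCommGroup G] [Fintype G] {T : G → ℝ}

/-- Summing the parallelogram inequality over a nontrivial coset of a proper subgroup `B`
containing `x`, all terms but those with `T x` cancel. -/
theorem nonneg_of_mem_of_parallelogram_le (heven : ∀ x, T (-x) = T x)
    (hpar : ∀ x y, x ≠ y → x ≠ -y → T (x + y) + T (x - y) ≤ 2 * T x + 2 * T y)
    {B : AddSubgroup G} (hB : B ≠ ⊤) {x : G} (hx : x ∈ B) : 0 ≤ T x := by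
  classical
  obtain ⟨y₀, hy₀⟩ : ∃ y₀, y₀ ∉ B := by
    by_contra! h
    exact hB ((AddSubgroup.eq_top_iff' B).2 h)
  set c : Finset G := Finset.univ.filter fun y => y - y₀ ∈ B with hc
  have hmem : ∀ y, y ∈ c ↔ y - y₀ ∈ B := fun y => by simp [hc]
  have hnot : ∀ y ∈ c, y ∉ B := fun y hy h => hy₀ <| by
    have := B.sub_mem h ((hmem y).1 hy)
    simpa using this
  have h1 : ∑ y ∈ c, T (x + y) = ∑ y ∈ c, T y := by
    refine Finset.sum_equiv (Equiv.addLeft x) (fun y => ?_) (fun y _ => rfl)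
    rw [hmem, hmem, Equiv.coe_addLeft, add_sub_assoc]
    exact (B.add_mem_cancel_left hx).symm
  have h2 : ∑ y ∈ c, T (x - y) = ∑ y ∈ c, T y := by
    refine Finset.sum_equiv (Equiv.subRight x) (fun y => ?_) (fun y _ => ?_)
    · rw [hmem, hmem, Equiv.subRight_apply, sub_right_comm]
      exact ⟨fun h => B.sub_mem h hx, fun h => by simpa using B.add_mem h hx⟩
    · rw [Equiv.subRight_apply, ← heven, neg_sub]
  have h3 : ∑ y ∈ c, (T (x + y) + T (x - y)) ≤ ∑ y ∈ c, (2 * T x + 2 * T y) := by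
    refine Finset.sum_le_sum fun y hy => hpar x y ?_ ?_
    · rintro rfl; exact hnot _ hy hx
    · rintro rfl; exact hnot y hy (by simpa using B.neg_mem hx)
  rw [Finset.sum_add_distrib, Finset.sum_add_distrib, h1, h2, ← Finset.mul_sum,
    ← Finset.mul_sum, Finset.sum_const, nsmul_eq_mul] at h3
  have hcpos : 0 < (c.card : ℝ) := by
    have : y₀ ∈ c := by rw [hmem]; simp
    exact_mod_cast Finset.card_pos.2 ⟨y₀, this⟩
  nlinarith

/-- Summing over all `y` compares the values at `x` and `2 x`. -/
theorem neg_mul_le_two_nsmul_of_parallelogram_le (heven : ∀ x, T (-x) = T x) (hzero : T 0 = 0)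
    (hsum : ∑ x, T x = 0)
    (hpar : ∀ x y, x ≠ y → x ≠ -y → T (x + y) + T (x - y) ≤ 2 * T x + 2 * T y)
    {x : G} (hx : x ≠ -x) : -((Fintype.card G : ℝ) - 4) * T x ≤ T (x + x) := by
  classical
  have h1 : ∑ y, T (x + y) = 0 := by rw [← hsum]; exact Equiv.sum_comp (Equiv.addLeft x) T
  have h2 : ∑ y, T (x - y) = 0 := by rw [← hsum]; exact Equiv.sum_comp (Equiv.subLeft x) T
  have h3 : ∑ y, (2 * T x + 2 * T y - (T (x + y) + T (x - y))) =
      2 * (Fintype.card G : ℝ) * T x := by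
    rw [Finset.sum_sub_distrib, Finset.sum_add_distrib, Finset.sum_add_distrib, h1, h2,
      ← Finset.mul_sum, ← Finset.mul_sum, hsum, Finset.sum_const, nsmul_eq_mul, Finset.card_univ]
    ring
  have h4 : ∑ y ∈ ({x, -x} : Finset G), (2 * T x + 2 * T y - (T (x + y) + T (x - y))) ≤
      ∑ y, (2 * T x + 2 * T y - (T (x + y) + T (x - y))) := by
    refine Finset.sum_le_sum_of_subset_of_nonneg (Finset.subset_univ _) fun y _ hy => ?_
    simp only [Finset.mem_insert, Finset.mem_singleton, not_or] at hy
    have := hpar x y (fun h => hy.1 h.symm) (fun h => hy.2 (by rw [h, neg_neg]))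
    linarith
  rw [h3, Finset.sum_pair hx, heven, sub_neg_eq_add, ← sub_eq_add_neg, sub_self, hzero] at h4
  linarith

theorem sum_two_nsmul_nonneg_of_parallelogram_le (heven : ∀ x, T (-x) = T x)
    (hsum : ∑ x, T x = 0)
    (hpar : ∀ x y, x ≠ y → x ≠ -y → T (x + y) + T (x - y) ≤ 2 * T x + 2 * T y) :
    0 ≤ ∑ x, T (x + x) := by
  let f : G →+ G := AddMonoidHom.id G + AddMonoidHom.id G
  by_cases h : f.range = ⊤
  · have hb : Function.Bijective f :=
      Finite.surjective_iff_bijective.1 (AddMonoidHom.range_eq_top.1 h)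
    exact ((Equiv.ofBijective f hb).sum_comp T).trans hsum |>.ge
  · exact Finset.sum_nonneg fun x _ =>
      nonneg_of_mem_of_parallelogram_le heven hpar h ⟨x, rfl⟩

/-- Summing over all parallelograms with diagonal `2 g`, for a generator `g` with `T g` minimal,
bounds `T (2 g)` from above. The lower bound of `neg_mul_le_two_nsmul_of_parallelogram_le`
exceeds it. -/
theorem eq_zero_of_parallelogram_le (hcard : 7 ≤ Fintype.card G) (heven : ∀ x, T (-x) = T x)
    (hzero : T 0 = 0) (hsum : ∑ x, T x = 0)
    (hpar : ∀ x y, x ≠ y → x ≠ -y → T (x + y) + T (x - y) ≤ 2 * T x + 2 * T y) : T = 0 := by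
  classical
  suffices hnn : ∀ x, 0 ≤ T x by
    funext x
    exact (Finset.sum_eq_zero_iff_of_nonneg fun x _ => hnn x).1 hsum x (Finset.mem_univ x)
  obtain ⟨g, hg⟩ := Finite.exists_min T
  suffices 0 ≤ T g from fun x => this.trans (hg x)
  by_contra! hneg
  have htop : AddSubgroup.zmultiples g = ⊤ := by
    by_contra h
    exact hneg.not_ge
      (nonneg_of_mem_of_parallelogram_le heven hpar h (AddSubgroup.mem_zmultiples g))
  have hcyc : IsAddCyclic G :=
    ⟨⟨g, fun x => (by rw [htop]; trivial : x ∈ AddSubgroup.zmultiples g)⟩⟩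
  have hcard' : (7 : ℝ) ≤ Fintype.card G := by exact_mod_cast hcard
  have hg2 : g ≠ -g := by
    intro h
    have h2 : 2 • g = 0 := by rw [two_nsmul]; nth_rewrite 2 [h]; simp
    have h3 := addOrderOf_le_of_nsmul_eq_zero (by norm_num) h2
    rw [← Nat.card_zmultiples, htop, AddSubgroup.card_top, Nat.card_eq_fintype_card] at h3
    omega
  have hlow := neg_mul_le_two_nsmul_of_parallelogram_le heven hzero hsum hpar hg2
  have hg20 : g + g ≠ 0 := fun h => hg2 (eq_neg_of_add_eq_zero_left h)
  set S : Finset G := Finset.univ.filter fun x => x + x = g + g with hS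
  have hScard : (S.card : ℝ) ≤ 2 := by
    have h1 := IsAddCyclic.card_nsmul_eq_zero_le (α := G) (n := 2) (by norm_num)
    have h2 : S.card ≤ (Finset.univ.filter fun a : G => 2 • a = 0).card := by
      refine Finset.card_le_card_of_injOn (fun x => x - g) (fun x hx => ?_)
        (fun x _ y _ h => by simpa using h)
      have hx' : x + x = g + g := by simpa [hS] using hx
      have : x - g + (x - g) = 0 := by rw [sub_add_sub_comm, hx', sub_self]
      simpa [two_nsmul] using this
    exact_mod_cast h2.trans h1
  have h1 : ∑ x, T (g + g - x) = 0 := by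
    rw [← hsum]; exact Equiv.sum_comp (Equiv.subLeft (g + g)) T
  have h2 : 0 ≤ ∑ x, T (x - (g + g - x)) := by
    refine (sum_two_nsmul_nonneg_of_parallelogram_le heven hsum hpar).trans_eq ?_
    rw [← Equiv.sum_comp (Equiv.subRight g)]
    refine Finset.sum_congr rfl fun x _ => ?_
    rw [Equiv.subRight_apply]
    congr 1
    abel
  have h3 : ∑ x, (2 * T x + 2 * T (g + g - x) - (T (g + g) + T (x - (g + g - x)))) ≤
      -(Fintype.card G : ℝ) * T (g + g) := by
    rw [Finset.sum_sub_distrib, Finset.sum_add_distrib, Finset.sum_add_distrib, ← Finset.mul_sum,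
      ← Finset.mul_sum, h1, hsum, Finset.sum_const, nsmul_eq_mul, Finset.card_univ]
    linarith
  have h4 : ∑ x ∈ S, (2 * T x + 2 * T (g + g - x) - (T (g + g) + T (x - (g + g - x)))) ≤
      ∑ x, (2 * T x + 2 * T (g + g - x) - (T (g + g) + T (x - (g + g - x)))) := by
    refine Finset.sum_le_sum_of_subset_of_nonneg (Finset.subset_univ _) fun x _ hx => ?_
    have hx' : x + x ≠ g + g := by simpa [hS] using hx
    have := hpar x (g + g - x) (fun h => hx' (by rw [eq_sub_iff_add_eq] at h; exact h))
      (fun h => hg20 (sub_eq_self.1 (by rwa [neg_sub, eq_comm] at h)))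
    rw [add_sub_cancel] at this
    linarith
  have h5 : (S.card : ℝ) * (4 * T g - T (g + g)) ≤
      ∑ x ∈ S, (2 * T x + 2 * T (g + g - x) - (T (g + g) + T (x - (g + g - x)))) := by
    rw [← nsmul_eq_mul]
    refine Finset.card_nsmul_le_sum _ _ _ fun x hx => ?_
    have hx' : x + x = g + g := by simpa [hS] using hx
    rw [← hx', add_sub_cancel_right, sub_self, hzero]
    linarith [hg x]
  have h6 : 0 ≤ T (g + g) := by nlinarith
  have h7 : 2 * (4 * T g - T (g + g)) ≤ (S.card : ℝ) * (4 * T g - T (g + g)) := by nlinarith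
  have h8 : ((Fintype.card G : ℝ) - 2) * T (g + g) ≤ -8 * T g := by linarith
  nlinarith

end Parallelogram

/-! ### Rigidity of flat distance functions -/

section Rigidity

/-- If `d a b = q (a - b)` for a quadratic form `q` on the augmentation ideal, then
`parallelogramDefect d a x y` is the value of `q` at `a + (a + x + y) - (a + x) - (a + y)`. -/
def parallelogramDefect {G : Type*} [AddCommGroup G] (d : G → G → ℝ) (a x y : G) : ℝ :=
  d a (a + x) + d a (a + y) + d (a + x) (a + x + y) + d (a + y) (a + x + y)
    - d a (a + x + y) - d (a + x) (a + y)

/-- A symmetric function vanishing on the diagonal is flat if its parallelogram defects vanish for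
all parallelograms with four different vertices and its sum over all translates of each pair
vanishes. The defects with `x = 0` or `y = 0` vanish for every such function, so that only
`x ≠ y` and `x ≠ -y` have to be required. -/
structure IsFlat {G : Type*} [AddCommGroup G] [Fintype G] (d : G → G → ℝ) : Prop where
  symm : ∀ a b, d a b = d b a
  diag : ∀ a, d a a = 0
  sum_translates : ∀ x, ∑ a, d a (a + x) = 0
  defect : ∀ a x y, x ≠ y → x ≠ -y → parallelogramDefect d a x y = 0

variable {G : Type*} [AddCommGroup G] [Fintype G] {d : G → G → ℝ}

namespace IsFlat

theorem comp_affine {H : Type*} [AddCommGroup H] [Fintype H] (hd : IsFlat d) (e : H ≃+ G)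
    (b : G) : IsFlat fun i j => d (b + e i) (b + e j) where
  symm i j := hd.symm _ _
  diag i := hd.diag _
  sum_translates x := by
    rw [← hd.sum_translates (e x), ← Equiv.sum_comp (e.toEquiv.trans (Equiv.addLeft b))]
    simp [add_assoc]
  defect i x y h1 h2 := by
    rw [← hd.defect (b + e i) (e x) (e y) (fun h => h1 (e.injective h))
      (fun h => h2 (e.injective (by rwa [map_neg])))]
    simp [parallelogramDefect, add_assoc]

/-- Summing the defects at `a` over all parallelograms with side `x` leaves only `d a (a + x)`. -/
theorem sum_defect (hd : IsFlat d) (a x : G) :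
    ∑ y, parallelogramDefect d a x y = Fintype.card G * d a (a + x) := by
  have h1 : ∑ y, d a (a + x + y) = ∑ y, d a (a + y) := by
    simp only [add_assoc]
    exact Equiv.sum_comp (Equiv.addLeft x) fun y => d a (a + y)
  have h2 : ∑ y, d (a + x) (a + x + y) = ∑ y, d (a + x) (a + y) := by
    simp only [add_assoc]
    exact Equiv.sum_comp (Equiv.addLeft x) fun y => d (a + x) (a + y)
  have h3 : ∑ y, d (a + y) (a + x + y) = 0 := by
    rw [← hd.sum_translates x, ← Equiv.sum_comp (Equiv.addLeft a) fun y => d y (y + x)]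
    simp only [Equiv.coe_addLeft, add_right_comm]
  simp only [parallelogramDefect, Finset.sum_sub_distrib, Finset.sum_add_distrib, h1, h2, h3,
    Finset.sum_const, nsmul_eq_mul, Finset.card_univ]
  ring

theorem eq_zero_of_add_self_eq_zero (hd : IsFlat d) (hcard : 4 < Fintype.card G) {x : G}
    (hx : x + x = 0) (a : G) : d a (a + x) = 0 := by
  have h1 : ∑ y, parallelogramDefect d a x y = parallelogramDefect d a x x := by
    refine Finset.sum_eq_single x (fun y _ hy => hd.defect a x y hy.symm fun h => hy ?_) (by simp)
    rw [eq_neg_of_add_eq_zero_left hx, h, neg_neg]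
  rw [hd.sum_defect, parallelogramDefect, add_assoc a x x, hx, add_zero, hd.diag, hd.diag,
    hd.symm (a + x) a] at h1
  have : (4 : ℝ) < Fintype.card G := by exact_mod_cast hcard
  nlinarith

/-- The contributions of the degenerate parallelograms `y = x` and `y = -x` to `sum_defect`. -/
theorem three_term (hd : IsFlat d) {x : G} (hx : x + x ≠ 0) (a : G) :
    ((Fintype.card G : ℝ) - 4) * d a (a + x) =
      2 * (d (a - x) a + d (a + x) (a + x + x)) - (d (a - x) (a + x) + d a (a + x + x)) := by
  classical
  have hne : x ≠ -x := fun h => hx (by nth_rewrite 1 [h]; simp)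
  have h1 : ∑ y, parallelogramDefect d a x y =
      ∑ y ∈ ({x, -x} : Finset G), parallelogramDefect d a x y := by
    refine (Finset.sum_subset (Finset.subset_univ _) fun y _ hy => ?_).symm
    simp only [Finset.mem_insert, Finset.mem_singleton, not_or] at hy
    exact hd.defect a x y (fun h => hy.1 h.symm) (fun h => hy.2 (by rw [h, neg_neg]))
  rw [hd.sum_defect, Finset.sum_pair hne, parallelogramDefect, parallelogramDefect,
    add_neg_cancel_right, hd.diag, hd.diag, ← sub_eq_add_neg, hd.symm a (a - x),
    hd.symm (a + x) a, hd.symm (a + x) (a - x)] at h1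
  linarith

/-- Summing the defects over parallelograms with side `x` whose second side runs through a coset
of the multiples of `x` shows that `d a (a + x)` changes sign between different cosets. -/
theorem eq_neg_of_notMem_zmultiples (hd : IsFlat d) {x y : G}
    (hy : y ∉ AddSubgroup.zmultiples x) (a : G) : d a (a + x) = -d (a + y) (a + y + x) := by
  classical
  set B := AddSubgroup.zmultiples x with hB
  have hx : x ∈ B := AddSubgroup.mem_zmultiples x
  -- the coset of `b`
  let c : G → Finset G := fun b => Finset.univ.filter fun z => z - b ∈ B
  have hmem : ∀ b z, z ∈ c b ↔ z - b ∈ B := fun b z => by simp [c]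
  have hshift : ∀ (f : G → ℝ) (b : G), ∑ z ∈ c b, f (x + z) = ∑ z ∈ c b, f z := fun f b => by
    refine Finset.sum_equiv (Equiv.addLeft x) (fun z => ?_) (fun y _ => rfl)
    rw [hmem, hmem, Equiv.coe_addLeft, add_sub_assoc]
    exact (B.add_mem_cancel_left hx).symm
  have hcongr : ∀ b b', b - b' ∈ B → c b = c b' := fun b b' h => by
    ext z
    rw [hmem, hmem, ← sub_add_sub_cancel z b b']
    exact (B.add_mem_cancel_right h).symm
  have hcard : ∀ b, (c b).card = (c 0).card := fun b => by
    refine Finset.card_equiv (Equiv.subRight b) fun z => ?_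
    rw [hmem, hmem, Equiv.subRight_apply, sub_zero]
  have hpos : 0 < ((c 0).card : ℝ) := by
    have : (0 : G) ∈ c 0 := by rw [hmem, sub_zero]; exact B.zero_mem
    exact_mod_cast Finset.card_pos.2 ⟨0, this⟩
  have hmain : ∀ b, ((c 0).card : ℝ) * d b (b + x) = -∑ z ∈ c (b + y), d z (z + x) := fun b => by
    have h0 : ∑ z ∈ c y, parallelogramDefect d b x z = 0 := by
      refine Finset.sum_eq_zero fun z hz => ?_
      have hzB : z ∉ B := fun h => hy <| by
        have := B.sub_mem h ((hmem _ _).1 hz)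
        simpa using this
      refine hd.defect b x z ?_ ?_
      · rintro rfl; exact hzB hx
      · rintro h; exact hzB (by rw [h] at hx; simpa using B.neg_mem hx)
    have h1 : ∑ z ∈ c y, d b (b + x + z) = ∑ z ∈ c y, d b (b + z) := by
      simp only [add_assoc]
      exact hshift (fun z => d b (b + z)) y
    have h2 : ∑ z ∈ c y, d (b + x) (b + x + z) = ∑ z ∈ c y, d (b + x) (b + z) := by
      simp only [add_assoc]
      exact hshift (fun z => d (b + x) (b + z)) y
    have h3 : ∑ z ∈ c y, d (b + z) (b + x + z) = ∑ z ∈ c (b + y), d z (z + x) := by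
      refine Finset.sum_equiv (Equiv.addLeft b) (fun z => ?_) (fun z _ => ?_)
      · rw [hmem, hmem, Equiv.coe_addLeft, add_sub_add_left_eq_sub]
      · rw [Equiv.coe_addLeft, add_right_comm]
    simp only [parallelogramDefect, Finset.sum_sub_distrib, Finset.sum_add_distrib, h1, h2, h3,
      Finset.sum_const, nsmul_eq_mul, hcard y] at h0
    linarith
  have hconst : ∀ b b', b - b' ∈ B → d b (b + x) = d b' (b' + x) := fun b b' h => by
    refine mul_left_cancel₀ hpos.ne' ?_
    rw [hmain, hmain, hcongr (b + y) (b' + y) (by rwa [add_sub_add_right_eq_sub])]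
  have h1 := hmain a
  rw [Finset.sum_congr rfl fun z hz => hconst z (a + y) ((hmem _ _).1 hz), Finset.sum_const,
    nsmul_eq_mul, hcard (a + y)] at h1
  refine mul_left_cancel₀ hpos.ne' ?_
  linarith

theorem eq_zero_of_two_mul_addOrderOf_lt (hd : IsFlat d) {x : G}
    (hx : 2 * addOrderOf x < Fintype.card G) (a : G) : d a (a + x) = 0 := by
  classical
  set B := AddSubgroup.zmultiples x with hB
  set b : Finset G := Finset.univ.filter (· ∈ B) with hb
  have hbcard : b.card = addOrderOf x := by
    rw [← Nat.card_zmultiples, ← hB, Nat.card_eq_fintype_card, hb, Fintype.card_subtype]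
  obtain ⟨y, hy⟩ : ∃ y, y ∉ b := by
    by_contra! h
    rw [(Finset.eq_univ_iff_forall.2 h), Finset.card_univ] at hbcard
    omega
  obtain ⟨z, hz⟩ : ∃ z, z ∉ b ∪ b.image (y + ·) := by
    by_contra! h
    have h1 := Finset.card_union_le b (b.image (y + ·))
    rw [(Finset.eq_univ_iff_forall.2 h), Finset.card_univ] at h1
    have h2 := Finset.card_image_le (s := b) (f := (y + ·))
    omega
  rw [Finset.mem_union, not_or] at hz
  have hy' : y ∉ B := by simpa [hb] using hy
  have hz' : z ∉ B := by simpa [hb] using hz.1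
  have hzy : z - y ∉ B := fun h => hz.2 (Finset.mem_image.2 ⟨z - y, by simpa [hb] using h, by simp⟩)
  have h1 := hd.eq_neg_of_notMem_zmultiples hy' a
  have h2 := hd.eq_neg_of_notMem_zmultiples hz' a
  have h3 := hd.eq_neg_of_notMem_zmultiples hzy (a + y)
  rw [show a + y + (z - y) = a + z by abel] at h3
  linarith

/-- Values at a generator that satisfy the discrete mean value property vanish. -/
theorem eq_zero_of_mean_value (hd : IsFlat d) {g : G} (hg : ∀ x, x ∈ AddSubgroup.zmultiples g)
    (h : ∀ a, 2 * d a (a + g) = d (a - g) a + d (a + g) (a + g + g)) (a : G) :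
    d a (a + g) = 0 := by
  set f : G → ℝ := fun a => d a (a + g) with hf
  have hdiff : ∀ (k : ℕ) b, f (b + k • g) = f b + k * (f (b + g) - f b) := by
    intro k b
    have hstep : ∀ b, f (b + g + g) - f (b + g) = f (b + g) - f b := fun b => by
      have := h (b + g)
      rw [add_sub_cancel_right] at this
      simp only [hf]
      linarith
    have hconst : ∀ k : ℕ, f (b + k • g + g) - f (b + k • g) = f (b + g) - f b := by
      intro k
      induction k with
      | zero => simp
      | succ k ih => rw [succ_nsmul, ← add_assoc, hstep, ih]
    induction k with
    | zero => simp
    | succ k ih =>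
      have := hconst k
      rw [succ_nsmul, ← add_assoc]
      push_cast
      linarith
  have hperiod : ∀ b, f (b + g) = f b := fun b => by
    have h1 := hdiff (Fintype.card G) b
    rw [card_nsmul_eq_zero, add_zero] at h1
    have h2 : (Fintype.card G : ℝ) ≠ 0 := by exact_mod_cast Fintype.card_ne_zero
    have h3 : (Fintype.card G : ℝ) * (f (b + g) - f b) = 0 := by linarith
    linarith [(mul_eq_zero.1 h3).resolve_left h2]
  have hconst : ∀ b, f b = f a := fun b => by
    obtain ⟨k, hk⟩ := mem_multiples_iff_mem_zmultiples.2 (hg (b - a))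
    have h1 := hdiff k a
    rw [hperiod, sub_self, mul_zero, add_zero] at h1
    rw [← h1]
    congr 1
    have hk' : k • g = b - a := hk
    rw [hk']
    abel
  have hsum := hd.sum_translates g
  rw [Finset.sum_congr rfl fun b _ => hconst b, Finset.sum_const, nsmul_eq_mul,
    Finset.card_univ] at hsum
  have h2 : (Fintype.card G : ℝ) ≠ 0 := by exact_mod_cast Fintype.card_ne_zero
  exact (mul_eq_zero.1 hsum).resolve_left h2

theorem eq_zero_of_ten_lt_card (hd : IsFlat d) (hcard : 10 < Fintype.card G) (a b : G) :
    d a b = 0 := by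
  obtain ⟨p, hp⟩ := Finite.exists_max fun p : G × G => |d p.1 p.2|
  obtain ⟨a₀, b₀⟩ := p
  set M := |d a₀ b₀| with hM
  have hle : ∀ a b, |d a b| ≤ M := fun a b => hp (a, b)
  have hcard' : (11 : ℝ) ≤ Fintype.card G := by exact_mod_cast hcard
  suffices M ≤ 0 from abs_nonpos_iff.1 ((hle a b).trans this)
  by_cases hx : (b₀ - a₀) + (b₀ - a₀) = 0
  · have := hd.eq_zero_of_add_self_eq_zero (by omega) hx a₀
    rw [add_sub_cancel] at this
    rw [hM, this, abs_zero]
  · have h := hd.three_term hx a₀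
    rw [add_sub_cancel] at h
    have h1 := abs_le.1 (hle (a₀ - (b₀ - a₀)) a₀)
    have h2 := abs_le.1 (hle b₀ (b₀ + (b₀ - a₀)))
    have h3 := abs_le.1 (hle (a₀ - (b₀ - a₀)) b₀)
    have h4 := abs_le.1 (hle a₀ (b₀ + (b₀ - a₀)))
    have h5 : ((Fintype.card G : ℝ) - 4) * M ≤ 6 * M := by
      rw [hM, ← abs_of_nonneg (show (0 : ℝ) ≤ Fintype.card G - 4 by linarith), ← abs_mul, ← hM, h]
      exact abs_le.2 ⟨by linarith, by linarith⟩
    nlinarith [abs_nonneg (d a₀ b₀)]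

end IsFlat

end Rigidity

/-! ### Rigidity for groups of order at most ten -/

section SmallGroups

variable {G : Type*} [AddCommGroup G] [Fintype G] {d : G → G → ℝ}

theorem mem_zmultiples_of_addOrderOf_eq_card {g : G} (hg : addOrderOf g = Fintype.card G) (x : G) :
    x ∈ AddSubgroup.zmultiples g := by
  have : AddSubgroup.zmultiples g = ⊤ := by
    rw [← AddSubgroup.card_eq_iff_eq_top, Nat.card_zmultiples, hg, Nat.card_eq_fintype_card]
  rw [this]
  trivial

theorem notMem_zmultiples_add_self {g : G} (heven : Even (addOrderOf g)) :
    g ∉ AddSubgroup.zmultiples (g + g) := by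
  rintro ⟨k, hk⟩
  obtain ⟨m, hm⟩ := heven
  have hpos : 0 < addOrderOf g := addOrderOf_pos g
  have h0 : m • g = 0 := by
    have hk' : k • (g + g) = g := hk
    rw [← hk', smul_comm, ← two_nsmul, ← mul_nsmul, mul_comm, mul_two, ← hm,
      addOrderOf_nsmul_eq_zero, smul_zero]
  have := Nat.le_of_dvd (by omega) (addOrderOf_dvd_of_nsmul_eq_zero h0)
  omega

/-- If `g` has even order, the elements `0` and `g` lie in different cosets of the multiples of
`2 g`, so the terms with difference `2 g` in the three-term relation cancel. -/
theorem IsFlat.three_term_of_even (hd : IsFlat d) {g : G} (heven : Even (addOrderOf g))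
    (hg : g + g ≠ 0) (a : G) : ((Fintype.card G : ℝ) - 4) * d a (a + g) =
      2 * (d (a - g) a + d (a + g) (a + g + g)) := by
  have h1 := hd.eq_neg_of_notMem_zmultiples (notMem_zmultiples_add_self heven) (a - g)
  have h2 := hd.three_term hg a
  rw [sub_add_cancel, ← add_assoc, sub_add_cancel, ← add_assoc] at h1
  linarith

/-- The defects of parallelograms with vertices in a cyclic group of order `7` form a nonsingular
linear system. -/
theorem IsFlat.zmod_seven {d : ZMod 7 → ZMod 7 → ℝ} (hd : IsFlat d) : d 0 1 = 0 := by
  have key : ∀ a x y p q r : ZMod 7, x ≠ y → x ≠ -y → a + x = p → a + y = q → a + x + y = r →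
      d a p + d a q + d p r + d q r - d a r - d p q = 0 := by
    rintro a x y p q r h1 h2 rfl rfl rfl
    exact hd.defect a x y h1 h2
  have s := hd.symm
  have a0 := key 0 1 2 1 2 3 (by decide) (by decide) (by decide) (by decide) (by decide)
  have a1 := key 1 1 2 2 3 4 (by decide) (by decide) (by decide) (by decide) (by decide)
  have a2 := key 2 1 2 3 4 5 (by decide) (by decide) (by decide) (by decide) (by decide)
  have a3 := key 3 1 2 4 5 6 (by decide) (by decide) (by decide) (by decide) (by decide)
  have a4 := key 4 1 2 5 6 0 (by decide) (by decide) (by decide) (by decide) (by decide)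
  have a5 := key 5 1 2 6 0 1 (by decide) (by decide) (by decide) (by decide) (by decide)
  have a6 := key 6 1 2 0 1 2 (by decide) (by decide) (by decide) (by decide) (by decide)
  have b0 := key 0 1 3 1 3 4 (by decide) (by decide) (by decide) (by decide) (by decide)
  have b1 := key 1 1 3 2 4 5 (by decide) (by decide) (by decide) (by decide) (by decide)
  have b2 := key 2 1 3 3 5 6 (by decide) (by decide) (by decide) (by decide) (by decide)
  have b3 := key 3 1 3 4 6 0 (by decide) (by decide) (by decide) (by decide) (by decide)
  have b4 := key 4 1 3 5 0 1 (by decide) (by decide) (by decide) (by decide) (by decide)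
  have b5 := key 5 1 3 6 1 2 (by decide) (by decide) (by decide) (by decide) (by decide)
  have b6 := key 6 1 3 0 2 3 (by decide) (by decide) (by decide) (by decide) (by decide)
  have c0 := key 0 2 3 2 3 5 (by decide) (by decide) (by decide) (by decide) (by decide)
  have c1 := key 1 2 3 3 4 6 (by decide) (by decide) (by decide) (by decide) (by decide)
  have c2 := key 2 2 3 4 5 0 (by decide) (by decide) (by decide) (by decide) (by decide)
  have c3 := key 3 2 3 5 6 1 (by decide) (by decide) (by decide) (by decide) (by decide)
  have c4 := key 4 2 3 6 0 2 (by decide) (by decide) (by decide) (by decide) (by decide)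
  have c5 := key 5 2 3 0 1 3 (by decide) (by decide) (by decide) (by decide) (by decide)
  have c6 := key 6 2 3 1 2 4 (by decide) (by decide) (by decide) (by decide) (by decide)
  simp only [s 2 0, s 3 0, s 4 0, s 5 0, s 6 0, s 3 1, s 4 1, s 5 1, s 6 1, s 4 2, s 5 2,
    s 6 2, s 5 3, s 6 3, s 6 4] at *
  linear_combination (25 * a0 - 3 * a1 - 17 * a2 - 17 * a3 - 3 * a4 + 25 * a5 + 11 * a6
    + 23 * b0 - 5 * b1 - 19 * b2 - 5 * b3 + 23 * b4 + 9 * b5 + 9 * b6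
    + c0 + 15 * c1 + 15 * c2 + c3 - 13 * c4 - 13 * c5 - 13 * c6) / 98

theorem IsFlat.eq_zero_of_card_eq_seven (hd : IsFlat d) (hcard : Fintype.card G = 7) (a x : G) :
    d a (a + x) = 0 := by
  rcases (Nat.dvd_prime (by norm_num)).1 (hcard ▸ addOrderOf_dvd_card (x := x)) with h | h
  · rw [AddMonoid.addOrderOf_eq_one_iff.1 h, add_zero, hd.diag]
  · let e := zmodAddEquivOfGenerator (mem_zmultiples_of_addOrderOf_eq_card (h.trans hcard.symm))
      (Nat.card_eq_fintype_card.trans hcard)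
    have h1 : e 1 = x := zmodAddEquivOfGenerator_apply_one _ _
    have := (hd.comp_affine e a).zmod_seven
    simpa [h1] using this

theorem nonempty_addEquiv_zmod_four_prod_zmod_two (hcard : Fintype.card G = 8)
    (h8 : ∀ g : G, addOrderOf g ≠ 8) {x : G} (hx : addOrderOf x = 4) :
    Nonempty (G ≃+ ZMod 4 × ZMod 2) := by
  have h4 : ∀ g : G, 4 • g = 0 := fun g => by
    have h1 : addOrderOf g ∣ 2 ^ 3 := (addOrderOf_dvd_card (x := g)).trans hcard.dvd
    obtain ⟨k, hk, hk'⟩ := (Nat.dvd_prime_pow Nat.prime_two).1 h1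
    refine addOrderOf_dvd_iff_nsmul_eq_zero.1 ?_
    have := h8 g
    interval_cases k <;> simp_all
  set B := AddSubgroup.zmultiples x with hB
  have hindex : B.index = 2 := by
    have := B.card_mul_index
    rw [Nat.card_zmultiples, hx, Nat.card_eq_fintype_card, hcard] at this
    omega
  -- an element of order two outside the multiples of `x`
  obtain ⟨t, ht, ht2⟩ : ∃ t : G, t ∉ B ∧ 2 • t = 0 := by
    obtain ⟨y, hy⟩ : ∃ y, y ∉ B := by
      by_contra! h
      rw [(AddSubgroup.eq_top_iff' B).2 h, AddSubgroup.index_top] at hindex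
      omega
    obtain ⟨k, hk⟩ : ∃ k : ℤ, k • x = y + y := AddSubgroup.add_self_mem_of_index_two hindex y
    have h2k : ((addOrderOf x : ℕ) : ℤ) ∣ 2 * k := by
      rw [addOrderOf_dvd_iff_zsmul_eq_zero, mul_zsmul, hk, ← h4 y]
      abel
    rw [hx] at h2k
    obtain ⟨j, hj⟩ : (2 : ℤ) ∣ k := by omega
    refine ⟨y - j • x, fun h => hy ?_, ?_⟩
    · simpa using B.add_mem h (B.zsmul_mem (AddSubgroup.mem_zmultiples x) j)
    · rw [smul_sub, two_nsmul, two_nsmul, ← hk, hj, two_mul, add_zsmul, sub_self]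
  let f : ZMod 4 × ZMod 2 →+ G := AddMonoidHom.coprod
    (ZMod.lift 4 ⟨zmultiplesHom G x, by simpa [ofNat_zsmul] using h4 x⟩)
    (ZMod.lift 2 ⟨zmultiplesHom G t, by simpa [ofNat_zsmul] using ht2⟩)
  have hinj : Function.Injective f := by
    rw [injective_iff_map_eq_zero]
    rintro ⟨u, v⟩ huv
    obtain ⟨u, rfl⟩ := ZMod.intCast_surjective u
    obtain ⟨v, rfl⟩ := ZMod.intCast_surjective v
    have huv' : u • x + v • t = 0 := by simpa [f] using huv
    have hv : (2 : ℤ) ∣ v := by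
      by_contra hv
      obtain ⟨w, hw⟩ : ∃ w, v = 2 * w + 1 := ⟨v / 2, by omega⟩
      have h1 : v • t = t := by
        have : (2 : ℤ) • t = 0 := by exact_mod_cast ht2
        rw [hw, add_zsmul, mul_comm, mul_zsmul, this, smul_zero, zero_add, one_zsmul]
      refine ht ⟨-u, ?_⟩
      rw [h1] at huv'
      simpa [neg_zsmul] using neg_eq_of_add_eq_zero_right huv'
    have h1 : v • t = 0 := by
      obtain ⟨w, rfl⟩ := hv
      have : (2 : ℤ) • t = 0 := by exact_mod_cast ht2
      rw [mul_comm, mul_zsmul, this, smul_zero]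
    rw [h1, add_zero, ← addOrderOf_dvd_iff_zsmul_eq_zero, hx] at huv'
    rw [Prod.mk_eq_zero]
    exact ⟨(ZMod.intCast_zmod_eq_zero_iff_dvd _ _).2 huv',
      (ZMod.intCast_zmod_eq_zero_iff_dvd _ _).2 hv⟩
  have hbij : Function.Bijective f := by
    rw [Fintype.bijective_iff_injective_and_card]
    exact ⟨hinj, by simp [hcard, ZMod.card]⟩
  exact ⟨(AddEquiv.ofBijective f hbij).symm⟩

/-- Generators satisfy the discrete mean value property. The parallelograms with sides `g` and
`3 g` then give the elements `2 g`. -/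
theorem IsFlat.eq_zero_of_card_eq_eight (hd : IsFlat d) (hcard : Fintype.card G = 8)
    (hG : ¬ Nonempty (G ≃+ ZMod 4 × ZMod 2)) (a x : G) : d a (a + x) = 0 := by
  classical
  have hgen : ∀ g : G, addOrderOf g = 8 → ∀ a, d a (a + g) = 0 := fun g hg => by
    have hg2 : g + g ≠ 0 := fun h => by
      have := addOrderOf_le_of_nsmul_eq_zero (x := g) (n := 2) (by norm_num) (by rwa [two_nsmul])
      omega
    refine hd.eq_zero_of_mean_value (mem_zmultiples_of_addOrderOf_eq_card (hg.trans hcard.symm))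
      fun a => ?_
    have := hd.three_term_of_even (hg ▸ by decide) hg2 a
    rw [hcard] at this
    push_cast at this
    linarith
  have hinv : ∀ z : G, z + z = 0 → ∀ a, d a (a + z) = 0 :=
    fun z hz => hd.eq_zero_of_add_self_eq_zero (by omega) hz
  have htwo : ∀ g : G, addOrderOf g = 8 → ∀ a, d a (a + (g + g)) = 0 := fun g hg a => by
    have h3 : addOrderOf (g + g + g) = 8 := by
      rw [show g + g + g = 3 • g by abel, Nat.Coprime.addOrderOf_nsmul (by rw [hg]; decide), hg]
    have h8 : 8 • g = 0 := hg ▸ addOrderOf_nsmul_eq_zero g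
    have hne : ∀ k : ℕ, 0 < k → k < 8 → k • g ≠ 0 := fun k h1 h2 h => by
      have := addOrderOf_le_of_nsmul_eq_zero h1 h
      omega
    have h := hd.defect (a - g) g (g + g + g)
      (fun h => hne 2 (by norm_num) (by norm_num) (by
        rw [eq_comm, add_assoc, add_eq_left] at h; rw [two_nsmul, h]))
      (fun h => hne 4 (by norm_num) (by norm_num) (by
        rw [eq_neg_iff_add_eq_zero] at h; rw [← h]; abel))
    have e1 := hgen g hg (a - g)
    have e2 := hgen _ h3 (a - g)
    have e3 := hgen _ h3 a
    have e4 := hgen g hg (a - g + (g + g + g))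
    have e5 := hinv (g + g + g + g) (by rw [← h8]; abel) (a - g)
    rw [parallelogramDefect, sub_add_cancel] at h
    rw [sub_add_cancel] at e1
    rw [show a - g + (g + g + g) = a + (g + g) by abel] at h e2 e4
    rw [show a + (g + g) + g = a + (g + g + g) by abel] at e4
    rw [show a - g + (g + g + g + g) = a + (g + g + g) by abel] at e5
    linarith
  have h1 : addOrderOf x ∣ 2 ^ 3 := (addOrderOf_dvd_card (x := x)).trans hcard.dvd
  obtain ⟨k, hk, hk'⟩ := (Nat.dvd_prime_pow Nat.prime_two).1 h1
  interval_cases k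
  · rw [AddMonoid.addOrderOf_eq_one_iff.1 hk', add_zero, hd.diag]
  · exact hinv x (by rw [← two_nsmul]; exact addOrderOf_dvd_iff_nsmul_eq_zero.1 hk'.dvd) a
  · obtain ⟨g, hg⟩ : ∃ g : G, addOrderOf g = 8 := by
      by_contra! h
      exact hG (nonempty_addEquiv_zmod_four_prod_zmod_two hcard h hk')
    obtain ⟨k, hk, rfl⟩ : ∃ k < 8, k • g = x := by
      have := mem_zmultiples_of_addOrderOf_eq_card (hg.trans hcard.symm) x
      rw [mem_zmultiples_iff_mem_range_addOrderOf, hg] at this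
      simpa using this
    rw [addOrderOf_nsmul, hg] at hk'
    interval_cases k <;> simp at hk'
    · rw [two_nsmul]; exact htwo g hg a
    · rw [show 6 • g = 3 • g + 3 • g by abel]
      exact htwo _ (by rw [Nat.Coprime.addOrderOf_nsmul (by rw [hg]; decide), hg]) a
  · exact hgen x hk' a

/-- Elements of order three have index three. For a generator `x`, the parallelograms with sides
`x` and `2 x` turn the three-term relation into the discrete mean value property. -/
theorem IsFlat.eq_zero_of_card_eq_nine (hd : IsFlat d) (hcard : Fintype.card G = 9) (a x : G) :
    d a (a + x) = 0 := by
  have h1 : addOrderOf x ∣ 3 ^ 2 := (addOrderOf_dvd_card (x := x)).trans hcard.dvd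
  obtain ⟨k, hk, hk'⟩ := (Nat.dvd_prime_pow Nat.prime_three).1 h1
  by_cases hk2 : k = 2
  swap
  · refine hd.eq_zero_of_two_mul_addOrderOf_lt ?_ a
    interval_cases k <;> omega
  subst hk2
  have hne : ∀ k : ℕ, 0 < k → k < 9 → k • x ≠ 0 := fun k h1 h2 h => by
    have := addOrderOf_le_of_nsmul_eq_zero h1 h
    omega
  have h9 : 9 • x = 0 := by
    have := addOrderOf_nsmul_eq_zero x
    rwa [hk'] at this
  have h3 : ∀ a, d a (a + (x + x + x)) = 0 := hd.eq_zero_of_two_mul_addOrderOf_lt (by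
    have := addOrderOf_le_of_nsmul_eq_zero (x := x + x + x) (n := 3) (by norm_num)
      (by rw [← h9]; abel)
    omega)
  refine hd.eq_zero_of_mean_value (mem_zmultiples_of_addOrderOf_eq_card (hk'.trans hcard.symm))
    (fun a => ?_) a
  have h2 := hd.three_term (fun h => hne 2 (by norm_num) (by norm_num) (by rw [two_nsmul, h])) a
  have h := hd.defect (a - x) x (x + x)
      (fun h => hne 1 (by norm_num) (by norm_num) (by
        rw [eq_comm, add_eq_left] at h; rw [one_nsmul, h]))
      (fun h => hne 3 (by norm_num) (by norm_num) (by
        rw [eq_neg_iff_add_eq_zero] at h; rw [← h]; abel))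
  have e := h3 (a - x)
  rw [parallelogramDefect, sub_add_cancel, show a - x + (x + x) = a + x by abel,
    ← add_assoc a x x] at h
  rw [show a - x + (x + x + x) = a + x + x by abel] at e
  rw [hcard] at h2
  push_cast at h2
  linarith

/-- Generators are settled by the maximum of `|d a (a + g)|`. For `2 g`, the parallelograms with
sides `g` and `3 g` give `d a (a + 4 g) = d a (a + 2 g)`, contradicting the three-term relation
for `2 g` unless both vanish. -/
theorem IsFlat.eq_zero_of_card_eq_ten (hd : IsFlat d) (hcard : Fintype.card G = 10) (a x : G) :
    d a (a + x) = 0 := by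
  have hgen : ∀ g : G, addOrderOf g = 10 → ∀ a, d a (a + g) = 0 := fun g hg => by
    have hg2 : g + g ≠ 0 := fun h => by
      have := addOrderOf_le_of_nsmul_eq_zero (x := g) (n := 2) (by norm_num) (by rwa [two_nsmul])
      omega
    obtain ⟨b, hb⟩ := Finite.exists_max fun a => |d a (a + g)|
    have h1 := hd.three_term_of_even (hg ▸ by decide) hg2 b
    have h2 := hb (b - g)
    have h3 := hb (b + g)
    rw [sub_add_cancel] at h2
    rw [hcard] at h1
    push_cast at h1
    have h0 : |d b (b + g)| ≤ 0 := by
      have h4 : 6 * |d b (b + g)| ≤ 4 * |d b (b + g)| := by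
        have h2' := abs_le.1 h2
        have h3' := abs_le.1 h3
        rw [← abs_of_pos (show (0 : ℝ) < 6 by norm_num), ← abs_mul, abs_le]
        constructor <;> linarith
      linarith
    exact fun a => abs_nonpos_iff.1 ((hb a).trans h0)
  have htwo : ∀ g : G, addOrderOf g = 10 → ∀ a, d a (a + (g + g)) = 0 := fun g hg a => by
    have h3 : addOrderOf (g + g + g) = 10 := by
      rw [show g + g + g = 3 • g by abel, Nat.Coprime.addOrderOf_nsmul (by rw [hg]; decide), hg]
    have hne : ∀ k : ℕ, 0 < k → k < 10 → k • g ≠ 0 := fun k h1 h2 h => by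
      have := addOrderOf_le_of_nsmul_eq_zero h1 h
      omega
    have hmem := notMem_zmultiples_add_self (g := g) (hg ▸ by decide)
    have hneg := hd.eq_neg_of_notMem_zmultiples hmem
    have hfour : ∀ a, d a (a + (g + g) + (g + g)) = d a (a + (g + g)) := fun a => by
      have h := hd.defect a g (g + g + g)
        (fun h => hne 2 (by norm_num) (by norm_num) (by
          rw [eq_comm, add_assoc, add_eq_left] at h; rw [two_nsmul, h]))
        (fun h => hne 4 (by norm_num) (by norm_num) (by
          rw [eq_neg_iff_add_eq_zero] at h; rw [← h]; abel))
      have e1 := hgen g hg a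
      have e2 := hgen _ h3 a
      have e3 := hgen _ h3 (a + g)
      have e4 := hgen g hg (a + (g + g + g))
      have e5 := hneg a
      rw [parallelogramDefect] at h
      rw [show a + (g + g + g) + g = a + g + (g + g + g) by abel] at e4
      rw [show a + (g + g) + (g + g) = a + g + (g + g + g) by abel]
      rw [show a + g + (g + g) = a + (g + g + g) by abel] at e5
      linarith
    have h1 := hd.three_term (x := g + g) (fun h => hne 4 (by norm_num) (by norm_num) (by
      rw [← h]; abel)) a
    have h2 := hfour (a - (g + g))
    have h3 := hfour a
    have e1 := hneg a
    have e2 := hneg (a + g)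
    have e3 := hneg (a - (g + g))
    have e4 := hneg (a - (g + g) + g)
    rw [show a + g + g = a + (g + g) by abel] at e2
    rw [show a - (g + g) + g + g = a by abel] at e4
    rw [sub_add_cancel] at h2 e3
    rw [hcard] at h1
    push_cast at h1
    linarith
  have h1 : addOrderOf x ∈ Nat.divisors 10 := by
    rw [Nat.mem_divisors]
    exact ⟨hcard ▸ addOrderOf_dvd_card (x := x), by norm_num⟩
  rw [show Nat.divisors 10 = {1, 2, 5, 10} by decide] at h1
  simp only [Finset.mem_insert, Finset.mem_singleton] at h1
  rcases h1 with h1 | h1 | h1 | h1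
  · rw [AddMonoid.addOrderOf_eq_one_iff.1 h1, add_zero, hd.diag]
  · refine hd.eq_zero_of_add_self_eq_zero (by omega) ?_ a
    rw [← two_nsmul]
    exact addOrderOf_dvd_iff_nsmul_eq_zero.1 h1.dvd
  · have : Fact (Nat.Prime 2) := ⟨Nat.prime_two⟩
    obtain ⟨t, ht⟩ := exists_prime_addOrderOf_dvd_card (G := G) 2 (by rw [hcard]; norm_num)
    have h3 : addOrderOf (3 • x) = 5 := by
      rw [Nat.Coprime.addOrderOf_nsmul (by rw [h1]; decide), h1]
    have hg : addOrderOf (3 • x + t) = 10 := by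
      rw [(AddCommute.all _ _).addOrderOf_add_eq_mul_addOrderOf_of_coprime (by
        rw [h3, ht]; decide), h3, ht]
    have h5 : 5 • x = 0 := h1 ▸ addOrderOf_nsmul_eq_zero x
    have ht2 : 2 • t = 0 := ht ▸ addOrderOf_nsmul_eq_zero t
    have hx : x = (3 • x + t) + (3 • x + t) := by
      rw [show (3 • x + t) + (3 • x + t) = 5 • x + 2 • t + x by abel, h5, ht2]
      simp
    rw [hx]
    exact htwo _ hg a
  · exact hgen x h1 a

theorem IsFlat.eq_zero (hd : IsFlat d) (hcard : 7 ≤ Fintype.card G)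
    (hG : ¬ Nonempty (G ≃+ ZMod 4 × ZMod 2)) : d = 0 := by
  funext a b
  rcases lt_or_ge 10 (Fintype.card G) with h | h
  · exact hd.eq_zero_of_ten_lt_card h a b
  · rw [← add_sub_cancel a b]
    obtain h | h | h | h : Fintype.card G = 7 ∨ Fintype.card G = 8 ∨ Fintype.card G = 9 ∨
        Fintype.card G = 10 := by omega
    · exact hd.eq_zero_of_card_eq_seven h a _
    · exact hd.eq_zero_of_card_eq_eight h hG a _
    · exact hd.eq_zero_of_card_eq_nine h a _
    · exact hd.eq_zero_of_card_eq_ten h a _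

end SmallGroups

/-! ### Perfection and eutaxy -/

section PerfectionEutaxy

variable {G : Type*} [AddCommGroup G] [Fintype G] {d : G → G → ℝ}

/-- Perfection and eutaxy together: a nonzero distance function of trace zero has a negative
defect. Its sums over translates satisfy the parallelogram inequality, so they vanish, which
turns all inequalities into equalities. -/
theorem eq_zero_of_parallelogramDefect_nonneg (hcard : 7 ≤ Fintype.card G)
    (hG : ¬ Nonempty (G ≃+ ZMod 4 × ZMod 2)) (hsymm : ∀ a b, d a b = d b a)
    (hdiag : ∀ a, d a a = 0) (hsum : ∑ a, ∑ b, d a b = 0)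
    (hdef : ∀ a x y, x ≠ 0 → y ≠ 0 → x ≠ y → x ≠ -y → 0 ≤ parallelogramDefect d a x y) :
    d = 0 := by
  have hdef' : ∀ a x y, x ≠ y → x ≠ -y → 0 ≤ parallelogramDefect d a x y := fun a x y h1 h2 => by
    by_cases hx : x = 0
    · subst hx
      simp [parallelogramDefect, hdiag]
    by_cases hy : y = 0
    · subst hy
      simp [parallelogramDefect, hdiag, hsymm (a + x) a]
    exact hdef a x y hx hy h1 h2
  let T : G → ℝ := fun x => ∑ a, d a (a + x)
  have hsumdef : ∀ x y, ∑ a, parallelogramDefect d a x y =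
      2 * T x + 2 * T y - (T (x + y) + T (x - y)) := fun x y => by
    have h1 : ∑ a, d (a + x) (a + x + y) = T y := by
      exact Equiv.sum_comp (Equiv.addRight x) fun a => d a (a + y)
    have h2 : ∑ a, d (a + y) (a + x + y) = T x := by
      simp only [add_right_comm _ x y]
      exact Equiv.sum_comp (Equiv.addRight y) fun a => d a (a + x)
    have h3 : ∑ a, d (a + x) (a + y) = T (x - y) := by
      simp only [T]
      rw [← Equiv.sum_comp (Equiv.addRight y) fun a => d a (a + (x - y))]
      refine Finset.sum_congr rfl fun a _ => ?_
      rw [Equiv.coe_addRight, hsymm, add_assoc a y, add_sub_cancel]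
    simp only [parallelogramDefect, Finset.sum_sub_distrib, Finset.sum_add_distrib, h1, h2, h3]
    simp only [T, ← add_assoc]
    ring
  have hT : T = 0 := by
    refine eq_zero_of_parallelogram_le hcard (fun x => ?_) ?_ ?_ fun x y h1 h2 => ?_
    · simp only [T]
      rw [← Equiv.sum_comp (Equiv.addRight x)]
      exact Finset.sum_congr rfl fun a _ => by simp [hsymm (a + x) a]
    · simp [T, hdiag]
    · simp only [T]
      rw [Finset.sum_comm, ← hsum]
      exact Finset.sum_congr rfl fun a _ => Equiv.sum_comp (Equiv.addLeft a) (d a)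
    · have := hsumdef x y
      have h0 := Finset.sum_nonneg fun a (_ : a ∈ Finset.univ) => hdef' a x y h1 h2
      linarith
  refine IsFlat.eq_zero ⟨hsymm, hdiag, fun x => congrFun hT x, fun a x y h1 h2 => ?_⟩ hcard hG
  have h0 := hsumdef x y
  simp only [hT, Pi.zero_apply, mul_zero, add_zero, sub_self] at h0
  exact (Finset.sum_eq_zero_iff_of_nonneg fun a _ => hdef' a x y h1 h2).1 h0 a (Finset.mem_univ a)

end PerfectionEutaxy

/-! ### A uniform bound by compactness -/

section Compactness

variable {G : Type*} [AddCommGroup G] [Fintype G]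

theorem parallelogramDefect_smul {G : Type*} [AddCommGroup G] (t : ℝ) (d : G → G → ℝ) (a x y : G) :
    parallelogramDefect (t • d) a x y = t * parallelogramDefect d a x y := by
  simp only [parallelogramDefect, Pi.smul_apply, smul_eq_mul]
  ring

theorem exists_parallelogramDefect_le (hcard : 7 ≤ Fintype.card G)
    (hG : ¬ Nonempty (G ≃+ ZMod 4 × ZMod 2)) :
    ∃ c : ℝ, 0 < c ∧ ∀ d : G → G → ℝ, (∀ a b, d a b = d b a) → (∀ a, d a a = 0) →
      ∑ a, ∑ b, d a b = 0 → ∃ a x y, x ≠ 0 ∧ y ≠ 0 ∧ x ≠ y ∧ x ≠ -y ∧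
        parallelogramDefect d a x y ≤ -c * ‖d‖ := by
  classical
  let S : Finset (G × G × G) :=
    Finset.univ.filter fun p => p.2.1 ≠ 0 ∧ p.2.2 ≠ 0 ∧ p.2.1 ≠ p.2.2 ∧ p.2.1 ≠ -p.2.2
  -- the total negative part of the defects
  let φ : (G → G → ℝ) → ℝ := fun d => ∑ p ∈ S, max (-parallelogramDefect d p.1 p.2.1 p.2.2) 0
  let K : Set (G → G → ℝ) := {d | (∀ a b, d a b = d b a) ∧ (∀ a, d a a = 0) ∧ ∑ a, ∑ b, d a b = 0}
  have hK : IsClosed K := by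
    simp only [K, Set.ofPred_and, Set.ofPred_forall]
    exact (isClosed_iInter fun a => isClosed_iInter fun b =>
        isClosed_eq (by fun_prop) (by fun_prop)).inter
      ((isClosed_iInter fun a => isClosed_eq (by fun_prop) (by fun_prop)).inter
        (isClosed_eq (by fun_prop) (by fun_prop)))
  have hφ : Continuous φ := by
    simp only [φ, parallelogramDefect]
    fun_prop
  have hpos : ∀ d ∈ K ∩ Metric.sphere 0 1, 0 < φ d := by
    rintro d ⟨⟨h1, h2, h3⟩, h4⟩
    by_contra! hle
    have h5 : φ d = 0 := hle.antisymm (Finset.sum_nonneg fun p _ => le_max_right _ _)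
    have h6 := (Finset.sum_eq_zero_iff_of_nonneg fun p _ => le_max_right _ _).1 h5
    have : d = 0 := eq_zero_of_parallelogramDefect_nonneg hcard hG h1 h2 h3
      fun a x y hx hy hxy hxy' => by
        have := h6 (a, x, y) (by simp [S, hx, hy, hxy, hxy'])
        have := max_eq_right_iff.1 this
        linarith
    rw [this] at h4
    simp at h4
  obtain ⟨c, hc, hcφ⟩ := ((isCompact_sphere (0 : G → G → ℝ) 1).inter_left hK).exists_forall_le'
    hφ.continuousOn hpos
  refine ⟨c / (S.card + 1), by positivity, fun d h1 h2 h3 => ?_⟩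
  by_cases hd : d = 0
  · obtain ⟨x, hx⟩ : ∃ x : G, x ≠ 0 := Fintype.exists_ne_of_one_lt_card (by omega) 0
    obtain ⟨y, hy⟩ : ∃ y : G, y ∉ ({0, x, -x} : Finset G) := by
      by_contra! h
      have h4 := Finset.card_le_three (a := (0 : G)) (b := x) (c := -x)
      rw [Finset.eq_univ_iff_forall.2 h, Finset.card_univ] at h4
      omega
    simp only [Finset.mem_insert, Finset.mem_singleton, not_or] at hy
    refine ⟨0, x, y, hx, hy.1, fun h => hy.2.1 h.symm, fun h => hy.2.2 (by rw [h, neg_neg]), ?_⟩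
    simp [hd, parallelogramDefect]
  by_contra! hcon
  have hnorm : 0 < ‖d‖ := norm_pos_iff.2 hd
  have h4 := hcφ (‖d‖⁻¹ • d) ⟨⟨fun a b => by simp [h1 a b], fun a => by simp [h2],
    by simp [← Finset.mul_sum, h3]⟩, by simp [norm_smul, hnorm.ne']⟩
  have h5 : φ (‖d‖⁻¹ • d) ≤ ∑ p ∈ S, c / (S.card + 1) := by
    refine Finset.sum_le_sum fun p hp => max_le ?_ (by positivity)
    simp only [S, Finset.mem_filter] at hp
    have h6 := hcon p.1 p.2.1 p.2.2 hp.2.1 hp.2.2.1 hp.2.2.2.1 hp.2.2.2.2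
    rw [parallelogramDefect_smul]
    have h7 : ‖d‖⁻¹ * (-(c / (S.card + 1)) * ‖d‖) ≤
        ‖d‖⁻¹ * parallelogramDefect d p.1 p.2.1 p.2.2 := by
      gcongr
    have h8 : ‖d‖⁻¹ * (-(c / (S.card + 1)) * ‖d‖) = -(c / (S.card + 1)) := by
      field_simp
    linarith
  have h6 := h4.trans h5
  rw [Finset.sum_const, nsmul_eq_mul, mul_div_assoc', le_div_iff₀ (by positivity)] at h6
  nlinarith

end Compactness

/-! ### The local comparison of minima and determinants -/

section Voronoi

/-- An orthonormal basis diagonalizing the quadratic form `‖g x‖ ^ 2`. -/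
theorem exists_orthonormalBasis_norm_sq_map {E : Type*} [NormedAddCommGroup E]
    [InnerProductSpace ℝ E] [FiniteDimensional ℝ E] (g : E →ₗ[ℝ] E) :
    ∃ (v : OrthonormalBasis (Fin (Module.finrank ℝ E)) ℝ E) (q : Fin (Module.finrank ℝ E) → ℝ),
      (∀ x, ‖g x‖ ^ 2 = ∑ j, q j * inner ℝ (v j) x ^ 2) ∧ LinearMap.det g ^ 2 = ∏ j, q j := by
  have hT := g.isSymmetric_adjoint_comp_self
  refine ⟨hT.eigenvectorBasis rfl, hT.eigenvalues rfl, fun x => ?_, ?_⟩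
  · have h1 : ‖g x‖ ^ 2 = inner ℝ x ((LinearMap.adjoint g ∘ₗ g) x) := by
      rw [LinearMap.comp_apply, LinearMap.adjoint_inner_right, real_inner_self_eq_norm_sq]
    rw [h1, ← (hT.eigenvectorBasis rfl).sum_inner_mul_inner]
    refine Finset.sum_congr rfl fun j _ => ?_
    rw [← hT, hT.apply_eigenvectorBasis, real_inner_smul_left,
      real_inner_comm (hT.eigenvectorBasis rfl j) x]
    simp
    ring
  · have h1 := hT.det_eq_prod_eigenvalues rfl
    rw [← LinearMap.normDet_sq, LinearMap.normDet_eq_abs_det] at h1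
    simpa using h1

/-- A consequence of `h - 2 * h ^ 2 ≤ log (1 + h)` for `|h| ≤ 1 / 2`. -/
theorem exp_le_prod_one_add {N : ℕ} {h : Fin N → ℝ} {η : ℝ} (hη : η ≤ 1 / 2)
    (hle : ∀ j, |h j| ≤ η) (hsum : ∑ j, h j = 0) :
    Real.exp (-(2 * η ^ 2)) ^ N ≤ ∏ j, (1 + h j) := by
  have h1 : ∀ j, Real.exp (h j - 2 * η ^ 2) ≤ 1 + h j := fun j => by
    have h2 := abs_le.1 (hle j)
    have hpos : 0 < 1 + h j := by linarith
    rw [← Real.le_log_iff_exp_le hpos]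
    refine le_trans ?_ (Real.one_sub_inv_le_log_of_pos hpos)
    have h3 : h j ^ 2 ≤ η ^ 2 := sq_le_sq' h2.1 h2.2
    have h4 : 1 - (1 + h j)⁻¹ - h j + 2 * h j ^ 2 = h j ^ 2 * (1 + 2 * h j) / (1 + h j) := by
      field_simp
      ring
    have h5 : 0 ≤ h j ^ 2 * (1 + 2 * h j) / (1 + h j) :=
      div_nonneg (mul_nonneg (sq_nonneg _) (by linarith)) hpos.le
    linarith
  calc Real.exp (-(2 * η ^ 2)) ^ N = ∏ j, Real.exp (h j - 2 * η ^ 2) := by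
        rw [← Real.exp_sum, Finset.sum_sub_distrib, hsum, ← Real.exp_nat_mul]
        simp
    _ ≤ ∏ j, (1 + h j) := Finset.prod_le_prod (fun j _ => (Real.exp_pos _).le) fun j _ => h1 j

theorem sum_mul_mul_sub_sq {G : Type*} [Fintype G] (c p : G → ℝ) (hc : ∑ a, c a = 0) :
    ∑ a, ∑ b, c a * c b * (p a - p b) ^ 2 = -2 * (∑ a, c a * p a) ^ 2 := by
  have h1 : ∀ a b, c a * c b * (p a - p b) ^ 2 =
      c a * p a ^ 2 * c b + c a * (c b * p b ^ 2) - 2 * ((c a * p a) * (c b * p b)) :=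
    fun a b => by ring
  simp only [h1, Finset.sum_sub_distrib, Finset.sum_add_distrib, ← Finset.mul_sum,
    ← Finset.sum_mul, hc]
  ring

variable {G : Type*} [AddCommGroup G]
variable {E : Type*} [NormedAddCommGroup E] [InnerProductSpace ℝ E]

/-- The vector `a + (a + x + y) - (a + x) - (a + y)` attached to a parallelogram, where `e a` stands
for the group element `a` up to a common translation. -/
def parallelogramVector (e : G → E) (a x y : G) : E :=
  e a + e (a + x + y) - e (a + x) - e (a + y)

theorem parallelogramDefect_eq_sum (e : G → E) {N : ℕ} (v : Fin N → E) (h : Fin N → ℝ)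
    (a x y : G) :
    parallelogramDefect (fun a b => ∑ j, h j * inner ℝ (v j) (e a - e b) ^ 2) a x y =
      ∑ j, h j * inner ℝ (v j) (parallelogramVector e a x y) ^ 2 := by
  simp only [parallelogramDefect, parallelogramVector, ← Finset.sum_add_distrib,
    ← Finset.sum_sub_distrib]
  refine Finset.sum_congr rfl fun j _ => ?_
  simp only [inner_sub_right, inner_add_right]
  ring

variable [Fintype G] [FiniteDimensional ℝ E]

/-- The local maximality of the density in terms of the vectors attached to parallelograms:
a map `g` close to the identity shortens one of them, of length `2`, to at most
`2 * |det g| ^ (1 / N)`. Write `‖g x‖ ^ 2 = s * (‖x‖ ^ 2 + h x)` with `h` of trace zero. Some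
parallelogram vector has `h x ≤ -κ * ‖h‖`, whereas `det g ^ 2 / s ^ N` differs from `1` only to
second order in `‖h‖`. -/
theorem exists_norm_parallelogramVector_pow_le (hcard : 7 ≤ Fintype.card G)
    (hG : ¬ Nonempty (G ≃+ ZMod 4 × ZMod 2)) (e : G → E)
    (htight : ∀ v : E, ∑ a, ∑ b, inner ℝ v (e a - e b) ^ 2 = 2 * Fintype.card G * ‖v‖ ^ 2)
    (hspan : ∀ v : E, ∃ c : G → ℝ, ∑ a, c a = 0 ∧ (∀ a, |c a| ≤ ‖v‖) ∧ v = ∑ a, c a • e a)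
    (hnorm : ∀ a x y, x ≠ 0 → y ≠ 0 → x ≠ y → x ≠ -y → ‖parallelogramVector e a x y‖ = 2) :
    ∃ ε : ℝ, 0 < ε ∧ ∀ g : E →L[ℝ] E, ‖g - ContinuousLinearMap.id ℝ E‖ < ε →
      ∃ a x y, x ≠ 0 ∧ y ≠ 0 ∧ x ≠ y ∧ x ≠ -y ∧
        ‖g (parallelogramVector e a x y)‖ ^ Module.finrank ℝ E ≤
          2 ^ Module.finrank ℝ E * |LinearMap.det (g : E →ₗ[ℝ] E)| := by
  obtain ⟨c, hc, hcd⟩ := exists_parallelogramDefect_le hcard hG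
  have hn : (7 : ℝ) ≤ Fintype.card G := by exact_mod_cast hcard
  set n : ℝ := ((Fintype.card G : ℕ) : ℝ) with hn_def
  set κ : ℝ := c / (2 * n ^ 2) with hκ
  have hκpos : 0 < κ := by positivity
  -- `16 * ε` bounds the coefficients `h j`; it has to be at most `1 / 2` and at most `κ / 2`
  refine ⟨min (1 / 32) (κ / 32), by positivity, fun g hg => ?_⟩
  set ε := ‖g - ContinuousLinearMap.id ℝ E‖ with hε
  have hε0 : 0 ≤ ε := norm_nonneg _
  have hε1 : ε < 1 / 32 := hg.trans_le (min_le_left _ _)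
  have hε2 : ε < κ / 32 := hg.trans_le (min_le_right _ _)
  obtain ⟨v, q, hq, hdet⟩ := exists_orthonormalBasis_norm_sq_map (g : E →ₗ[ℝ] E)
  generalize hN : Module.finrank ℝ E = N at v q
  have hNpos : 0 < N := by
    obtain ⟨a, x, y, h1, h2, h3, h4, -⟩ := hcd 0 (by simp) (by simp) (by simp)
    have h5 := hnorm a x y h1 h2 h3 h4
    have : Nontrivial E := ⟨_, 0, norm_ne_zero_iff.1 (by rw [h5]; norm_num)⟩
    rw [← hN]
    exact Module.finrank_pos
  have hN' : (0 : ℝ) < N := by exact_mod_cast hNpos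
  -- the eigenvalues are close to `1`
  have hqv : ∀ j, q j = ‖g (v j)‖ ^ 2 := fun j => by
    have := hq (v j)
    rw [ContinuousLinearMap.coe_coe] at this
    rw [this, Finset.sum_eq_single j (fun i _ hi => by simp [v.orthonormal.2 hi]) (by simp)]
    simp
  have hgv : ∀ j, |‖g (v j)‖ - 1| ≤ ε := fun j => by
    have h1 := abs_norm_sub_norm_le (g (v j)) (v j)
    have h2 := (g - ContinuousLinearMap.id ℝ E).le_opNorm (v j)
    rw [v.norm_eq_one] at h1 h2
    simp only [sub_apply, ContinuousLinearMap.id_apply, mul_one] at h2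
    exact h1.trans h2
  have hqlow : ∀ j, (1 - ε) ^ 2 ≤ q j := fun j => by
    have := abs_le.1 (hgv j)
    rw [hqv]
    exact pow_le_pow_left₀ (by linarith) (by linarith) 2
  have hqup : ∀ j, q j ≤ (1 + ε) ^ 2 := fun j => by
    have := abs_le.1 (hgv j)
    rw [hqv]
    exact pow_le_pow_left₀ (norm_nonneg _) (by linarith) 2
  set s : ℝ := (∑ j, q j) / N with hs
  have hslow : (1 - ε) ^ 2 ≤ s := by
    rw [hs, le_div_iff₀ hN']
    have := Finset.card_nsmul_le_sum Finset.univ q _ fun j _ => hqlow j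
    rw [Finset.card_univ, Fintype.card_fin, nsmul_eq_mul] at this
    linarith
  have hsup : s ≤ (1 + ε) ^ 2 := by
    rw [hs, div_le_iff₀ hN']
    have := Finset.sum_le_card_nsmul Finset.univ q _ fun j _ => hqup j
    rw [Finset.card_univ, Fintype.card_fin, nsmul_eq_mul] at this
    linarith
  have hspos : 1 / 2 ≤ s := le_trans (by nlinarith) hslow
  let h : Fin N → ℝ := fun j => q j / s - 1
  have hqh : ∀ j, q j = s * (1 + h j) := fun j => by
    have : s ≠ 0 := by linarith
    simp only [h]
    field_simp
    ring
  have hsum : ∑ j, h j = 0 := by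
    have h1 : ∑ j, q j = s * N := by rw [hs]; field_simp
    simp only [h]
    rw [Finset.sum_sub_distrib, ← Finset.sum_div, h1]
    have : s ≠ 0 := by linarith
    field_simp
    simp
  have hsmall : ‖h‖ ≤ 16 * ε := by
    refine (pi_norm_le_iff_of_nonneg (by positivity)).2 fun j => ?_
    have h1 : h j = (q j - s) / s := by
      have : s ≠ 0 := by linarith
      simp only [h]
      field_simp
    rw [Real.norm_eq_abs, h1, abs_div, abs_of_pos (show 0 < s by linarith),
      div_le_iff₀ (by linarith), abs_le]
    have := hqlow j
    have := hqup j
    constructor <;> nlinarith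
  have hhj : ∀ j, |h j| ≤ ‖h‖ := fun j => norm_le_pi_norm h j
  -- the distance function of the trace zero form
  let d : G → G → ℝ := fun a b => ∑ j, h j * inner ℝ (v j) (e a - e b) ^ 2
  obtain ⟨a, x, y, hx, hy, hxy, hxy', hle⟩ := hcd d
    (fun a b => Finset.sum_congr rfl fun j _ => by
      rw [← neg_sub (e b) (e a), inner_neg_right, neg_sq])
    (fun a => by simp [d])
    (by
      have h1 : ∑ a, ∑ b, d a b = ∑ j, h j * ∑ a, ∑ b, inner ℝ (v j) (e a - e b) ^ 2 := by
        simp only [d, Finset.mul_sum]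
        rw [Finset.sum_comm (s := (Finset.univ : Finset (Fin N)))]
        refine Finset.sum_congr rfl fun a _ => ?_
        rw [Finset.sum_comm (s := (Finset.univ : Finset (Fin N)))]
      rw [h1]
      simp only [htight, v.norm_eq_one]
      rw [← Finset.sum_mul, hsum, zero_mul])
  have hdnorm : ‖h‖ ≤ n ^ 2 / 2 * ‖d‖ := by
    refine (pi_norm_le_iff_of_nonneg (by positivity)).2 fun i => ?_
    obtain ⟨k, hk0, hk1, hk⟩ := hspan (v i)
    rw [v.norm_eq_one] at hk1
    have h1 : ∑ a, ∑ b, k a * k b * d a b = -2 * h i := by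
      have h2 : ∑ a, ∑ b, k a * k b * d a b =
          ∑ j, h j * ∑ a, ∑ b, k a * k b * (inner ℝ (v j) (e a) - inner ℝ (v j) (e b)) ^ 2 := by
        simp only [d, Finset.mul_sum, inner_sub_right]
        rw [Finset.sum_comm (s := (Finset.univ : Finset (Fin N)))]
        refine Finset.sum_congr rfl fun a _ => ?_
        rw [Finset.sum_comm (s := (Finset.univ : Finset (Fin N)))]
        exact Finset.sum_congr rfl fun b _ => Finset.sum_congr rfl fun j _ => by ring
      have h3 : ∀ j, ∑ a, k a * inner ℝ (v j) (e a) = inner ℝ (v j) (v i) := fun j => by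
        rw [hk, inner_sum]
        exact Finset.sum_congr rfl fun a _ => by rw [real_inner_smul_right]
      rw [h2]
      simp only [sum_mul_mul_sub_sq k _ hk0, h3]
      rw [Finset.sum_eq_single i (fun j _ hj => by simp [v.orthonormal.2 hj]) (by simp)]
      simp
      ring
    have h4 : |∑ a, ∑ b, k a * k b * d a b| ≤ ∑ a : G, ∑ b : G, ‖d‖ := by
      refine (Finset.abs_sum_le_sum_abs _ _).trans (Finset.sum_le_sum fun a _ => ?_)
      refine (Finset.abs_sum_le_sum_abs _ _).trans (Finset.sum_le_sum fun b _ => ?_)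
      have h5 : |d a b| ≤ ‖d‖ := (norm_le_pi_norm (d a) b).trans (norm_le_pi_norm d a)
      rw [abs_mul, abs_mul]
      have h6 : |k a| * |k b| ≤ 1 := mul_le_one₀ (hk1 a) (abs_nonneg _) (hk1 b)
      nlinarith [abs_nonneg (d a b)]
    rw [h1, abs_mul] at h4
    simp only [Finset.sum_const, Finset.card_univ, nsmul_eq_mul] at h4
    rw [← hn_def, abs_neg, abs_two] at h4
    rw [Real.norm_eq_abs]
    linarith
  refine ⟨a, x, y, hx, hy, hxy, hxy', ?_⟩
  set m := parallelogramVector e a x y with hm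
  have hm2 : ‖m‖ = 2 := hnorm a x y hx hy hxy hxy'
  have hgm : ‖g m‖ ^ 2 = s * (4 + parallelogramDefect d a x y) := by
    have h1 := hq m
    rw [ContinuousLinearMap.coe_coe] at h1
    have h2 : ∑ j, inner ℝ (v j) m ^ 2 = 4 := by
      rw [v.sum_sq_inner_right, hm2]
      norm_num
    rw [h1, parallelogramDefect_eq_sum, ← hm, ← h2, ← Finset.sum_add_distrib, Finset.mul_sum]
    exact Finset.sum_congr rfl fun j _ => by rw [hqh j]; ring
  have hgm' : ‖g m‖ ^ 2 ≤ 4 * s * Real.exp (-(2 * ‖h‖ ^ 2)) := by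
    have h1 : κ * ‖h‖ ≤ c * ‖d‖ / 4 := by
      rw [hκ, div_mul_eq_mul_div, div_le_iff₀ (by positivity)]
      nlinarith
    have h2 : 2 * ‖h‖ ^ 2 ≤ κ * ‖h‖ := by nlinarith [norm_nonneg h]
    have h3 := Real.add_one_le_exp (-(2 * ‖h‖ ^ 2))
    have h4 : 4 + parallelogramDefect d a x y ≤ 4 * Real.exp (-(2 * ‖h‖ ^ 2)) := by linarith
    rw [hgm]
    nlinarith
  have hprod := exp_le_prod_one_add (h := h) (η := ‖h‖) (by linarith) hhj hsum
  refine le_of_sq_le_sq ?_ (by positivity)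
  calc (‖g m‖ ^ N) ^ 2 = (‖g m‖ ^ 2) ^ N := by rw [← pow_mul, ← pow_mul, mul_comm]
    _ ≤ (4 * s * Real.exp (-(2 * ‖h‖ ^ 2))) ^ N := pow_le_pow_left₀ (by positivity) hgm' N
    _ = (4 * s) ^ N * Real.exp (-(2 * ‖h‖ ^ 2)) ^ N := mul_pow _ _ _
    _ ≤ (4 * s) ^ N * ∏ j, (1 + h j) := by gcongr
    _ = 4 ^ N * ∏ j, q j := by
      simp only [hqh, Finset.prod_mul_distrib, Finset.prod_const, Finset.card_univ,
        Fintype.card_fin, mul_pow]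
      ring
    _ = (2 ^ N * |LinearMap.det (g : E →ₗ[ℝ] E)|) ^ 2 := by
      rw [mul_pow, sq_abs, hdet, ← pow_mul, mul_comm N 2, pow_mul]
      norm_num

end Voronoi

/-! ### Packing density under linear maps -/

section Density

variable {E : Type*} [NormedAddCommGroup E]

theorem minDist_nonneg (L : Submodule ℤ E) : 0 ≤ minDist L :=
  Real.sInf_nonneg (by rintro _ ⟨x, -, -, rfl⟩; exact norm_nonneg x)

theorem minDist_le_norm {L : Submodule ℤ E} {x : E} (hx : x ∈ L) (hx0 : x ≠ 0) :
    minDist L ≤ ‖x‖ :=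
  csInf_le ⟨0, by rintro _ ⟨x, -, -, rfl⟩; exact norm_nonneg x⟩ ⟨x, hx, hx0, rfl⟩

variable [InnerProductSpace ℝ E] [FiniteDimensional ℝ E] [MeasurableSpace E] [BorelSpace E]

theorem covolume_map_continuousLinearEquiv (L : Submodule ℤ E) [DiscreteTopology L]
    [IsZLattice ℝ L] (g : E ≃L[ℝ] E) :
    ZLattice.covolume (L.map (g.toLinearEquiv.toLinearMap.restrictScalars ℤ)) =
      |LinearMap.det (g : E →ₗ[ℝ] E)| * ZLattice.covolume L := by
  have h1 : L.map (g.toLinearEquiv.toLinearMap.restrictScalars ℤ) =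
      ZLattice.comap ℝ L g.symm.toLinearMap := by
    ext x
    constructor
    · rintro ⟨y, hy, rfl⟩
      change g.symm (g y) ∈ L
      rwa [g.symm_apply_apply]
    · intro hx
      exact ⟨g.symm x, hx, g.apply_symm_apply x⟩
  rw [h1, ZLattice.covolume_eq_measure_fundamentalDomain L volume
      (ZLattice.isAddFundamentalDomain (Module.Free.chooseBasis ℤ L) volume),
    ZLattice.covolume_eq_measure_fundamentalDomain _ _ (ZLattice.isAddFundamentalDomain
      ((Module.Free.chooseBasis ℤ L).ofZLatticeComap ℝ L g.symm.toLinearEquiv) volume),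
    Module.Basis.ofZLatticeBasis_comap, ← ZSpan.map_fundamentalDomain]
  have h2 := Measure.addHaar_image_linearMap (volume : Measure E) (g : E →ₗ[ℝ] E)
    (ZSpan.fundamentalDomain ((Module.Free.chooseBasis ℤ L).ofZLatticeBasis ℝ L))
  rw [measureReal_def, measureReal_def, ← ENNReal.toReal_ofReal (abs_nonneg (LinearMap.det _)),
    ← ENNReal.toReal_mul, ← h2]
  rfl

theorem packingDensity_eq [Nontrivial E] (L : Submodule ℤ E) : packingDensity L =
    (minDist L / 2) ^ Module.finrank ℝ E * (volume : Measure E).real (Metric.ball 0 1) /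
      ZLattice.covolume L := by
  rw [packingDensity, measureReal_def, Measure.addHaar_ball _ _
    (div_nonneg (minDist_nonneg L) zero_le_two), ENNReal.toReal_mul,
    ENNReal.toReal_ofReal (pow_nonneg (div_nonneg (minDist_nonneg L) zero_le_two) _),
    measureReal_def]

theorem packingDensity_map_le [Nontrivial E] {L : Submodule ℤ E} [DiscreteTopology L]
    [IsZLattice ℝ L] (g : E ≃L[ℝ] E)
    (h : minDist (L.map (g.toLinearEquiv.toLinearMap.restrictScalars ℤ)) ^ Module.finrank ℝ E ≤
      minDist L ^ Module.finrank ℝ E * |LinearMap.det (g : E →ₗ[ℝ] E)|) :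
    packingDensity (L.map (g.toLinearEquiv.toLinearMap.restrictScalars ℤ)) ≤
      packingDensity L := by
  have hdet : 0 < |LinearMap.det (g : E →ₗ[ℝ] E)| :=
    abs_pos.2 g.toLinearEquiv.isUnit_det'.ne_zero
  have hcov := ZLattice.covolume_pos L (volume : Measure E)
  rw [packingDensity_eq, packingDensity_eq, covolume_map_continuousLinearEquiv,
    div_le_div_iff₀ (by positivity) hcov, div_pow, div_pow]
  calc _ = minDist (L.map (g.toLinearEquiv.toLinearMap.restrictScalars ℤ)) ^ Module.finrank ℝ E *
        (volume.real (Metric.ball (0 : E) 1) / 2 ^ Module.finrank ℝ E * ZLattice.covolume L) := by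
        ring
    _ ≤ _ := mul_le_mul_of_nonneg_right h (by positivity)
    _ = _ := by ring

theorem isZLattice_latticeInSpan {V : Type*} [NormedAddCommGroup V] [InnerProductSpace ℝ V]
    (L : Submodule ℤ V) [DiscreteTopology L] :
    DiscreteTopology (latticeInSpan L) ∧
      Submodule.span ℝ (latticeInSpan L : Set (Submodule.span ℝ (L : Set V))) = ⊤ :=
  ⟨ZLattice.comap_discreteTopology ℝ L continuous_subtype_val Subtype.val_injective,
    Submodule.span_span_coe_preimage⟩

end Density

/-! ### The lattice of a finite abelian group -/

section GroupLattice

variable {A : Type*} [CommGroup A] [Fintype A]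

theorem mem_lattice_iff {x : EuclideanSpace ℝ A} :
    x ∈ lattice A ↔ ∃ k : A → ℤ, ∑ a, k a = 0 ∧ ∏ a, a ^ k a = 1 ∧ ∀ a, x a = k a := by
  constructor
  · rintro ⟨r, ⟨h1, h2⟩, rfl⟩
    refine ⟨fun a => r.coeff a, ?_, ?_, fun a => rfl⟩
    · rw [← augmentation_apply]
      exact h2
    · exact Additive.ofMul.injective h1
  · rintro ⟨k, h1, h2, h3⟩
    let r : MonoidAlgebra ℤ A := ∑ a, MonoidAlgebra.single a (k a)
    have hr : ∀ a, r.coeff a = k a := fun a => by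
      classical
      simp [r, MonoidAlgebra.coeff_sum, Finsupp.finsetSum_apply, Finsupp.single_apply]
    refine ⟨r, ⟨?_, ?_⟩, ?_⟩
    · change Additive.ofMul (∏ a, a ^ r.coeff a) = 0
      simp only [hr, h2, ofMul_one]
    · change augmentation A r = 0
      rw [augmentation_apply]
      simp only [hr, h1]
    · ext a
      rw [h3]
      change ((r.coeff a : ℤ) : ℝ) = _
      rw [hr]

/-- Vectors of squared length two would have the form `p - m`, which forces `p = m`. -/
theorem four_le_sum_sq {k : A → ℤ} (hsum : ∑ a, k a = 0) (hprod : ∏ a, a ^ k a = 1)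
    (hk : k ≠ 0) : 4 ≤ ∑ a, k a ^ 2 := by
  classical
  by_contra! hlt
  have heven : (2 : ℤ) ∣ ∑ a, k a ^ 2 := by
    have h1 : (2 : ℤ) ∣ ∑ a, (k a ^ 2 - k a) := Finset.dvd_sum fun a _ => by
      rw [sq, ← mul_sub_one]
      exact (Int.even_mul_pred_self (k a)).two_dvd
    rwa [Finset.sum_sub_distrib, hsum, sub_zero] at h1
  have hle : ∑ a, k a ^ 2 ≤ 2 := by omega
  have hne : ∃ a ∈ (Finset.univ : Finset A), k a ≠ 0 := by
    obtain ⟨a, ha⟩ := Function.ne_iff.1 hk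
    exact ⟨a, Finset.mem_univ a, ha⟩
  obtain ⟨p, -, hp⟩ := Finset.exists_pos_of_sum_zero_of_exists_nonzero k hsum hne
  obtain ⟨m, -, hm⟩ : ∃ m ∈ (Finset.univ : Finset A), 0 < -k m :=
    Finset.exists_pos_of_sum_zero_of_exists_nonzero (fun a => -k a) (by simp [hsum])
      (by simpa using hne)
  have hpm : p ≠ m := by rintro rfl; omega
  have hsplit : ∑ a, k a ^ 2 = k p ^ 2 + k m ^ 2 + ∑ a ∈ Finset.univ \ {p, m}, k a ^ 2 := by
    rw [← Finset.sum_sdiff (Finset.subset_univ {p, m}), Finset.sum_pair hpm, add_comm]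
  have hnn : 0 ≤ ∑ a ∈ Finset.univ \ {p, m}, k a ^ 2 := Finset.sum_nonneg fun a _ => sq_nonneg _
  have hp1 : k p = 1 := by nlinarith
  have hm1 : k m = -1 := by nlinarith
  have hrest : ∑ a ∈ Finset.univ \ {p, m}, k a ^ 2 = 0 := by
    rw [hp1, hm1] at hsplit
    linarith
  have hzero := (Finset.sum_eq_zero_iff_of_nonneg fun a _ => sq_nonneg (k a)).1 hrest
  have h1 : ∏ a, a ^ k a = ∏ a ∈ {p, m}, a ^ k a := by
    refine (Finset.prod_subset (Finset.subset_univ _) fun a _ ha => ?_).symm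
    rw [pow_eq_zero_iff two_ne_zero |>.1 (hzero a (by simpa using ha)), zpow_zero]
  rw [hprod, Finset.prod_pair hpm, hp1, hm1, zpow_one, zpow_neg_one, eq_comm,
    mul_inv_eq_one] at h1
  exact hpm h1

theorem two_le_norm_of_mem_lattice {x : EuclideanSpace ℝ A} (hx : x ∈ lattice A) (hx0 : x ≠ 0) :
    2 ≤ ‖x‖ := by
  obtain ⟨k, h1, h2, h3⟩ := mem_lattice_iff.1 hx
  have hk : k ≠ 0 := by
    rintro rfl
    exact hx0 (by ext a; simp [h3])
  have h4 := four_le_sum_sq h1 h2 hk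
  have h5 : (4 : ℝ) ≤ ‖x‖ ^ 2 := by
    rw [EuclideanSpace.real_norm_sq_eq]
    simp only [h3]
    exact_mod_cast h4
  nlinarith [norm_nonneg x]

instance discreteTopology_lattice : DiscreteTopology (lattice A) := by
  refine discreteTopology_of_isOpen_singleton_zero (Metric.isOpen_singleton_iff.2
    ⟨2, two_pos, fun y hy => ?_⟩)
  by_contra h
  have := two_le_norm_of_mem_lattice y.2 (fun h' => h (Subtype.ext h'))
  rw [dist_zero_right] at hy
  exact absurd hy this.not_gt

theorem sum_eq_zero_of_mem_span_lattice {x : EuclideanSpace ℝ A}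
    (hx : x ∈ Submodule.span ℝ (lattice A : Set (EuclideanSpace ℝ A))) : ∑ a, x a = 0 := by
  induction hx using Submodule.span_induction with
  | mem x hx =>
    obtain ⟨k, h1, -, h3⟩ := mem_lattice_iff.1 hx
    simp only [h3]
    exact_mod_cast h1
  | zero => simp
  | add x y _ _ hx hy => simp [Finset.sum_add_distrib, hx, hy]
  | smul c x _ hx => simp [← Finset.mul_sum, hx]

open Classical in
theorem single_sub_single_mem_span_lattice (a b : A) :
    EuclideanSpace.single a (1 : ℝ) - EuclideanSpace.single b 1 ∈
      Submodule.span ℝ (lattice A : Set (EuclideanSpace ℝ A)) := by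
  have hn : (Fintype.card A : ℝ) ≠ 0 := by exact_mod_cast Fintype.card_ne_zero
  have h1 : (Fintype.card A : ℝ) • (EuclideanSpace.single a (1 : ℝ) - EuclideanSpace.single b 1) ∈
      lattice A := by
    refine mem_lattice_iff.2 ⟨fun c => Fintype.card A * (Pi.single a 1 - Pi.single b 1 : A → ℤ) c,
      ?_, ?_, fun c => ?_⟩
    · rw [← Finset.mul_sum]
      simp
    · simp only [zpow_mul, zpow_natCast, pow_card_eq_one, one_zpow, Finset.prod_const_one]
    · simp [Pi.single_apply]
  rw [← inv_smul_smul₀ hn (EuclideanSpace.single a (1 : ℝ) - EuclideanSpace.single b 1)]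
  exact Submodule.smul_mem _ _ (Submodule.subset_span h1)

open Classical in
/-- The element `a - 1` of the group ring, as a vector in the span of the lattice. The index type
is `Additive A`, where parallelograms are written additively. -/
noncomputable def baseVector (a : Additive A) :
    Submodule.span ℝ (lattice A : Set (EuclideanSpace ℝ A)) :=
  ⟨EuclideanSpace.single a.toMul 1 - EuclideanSpace.single 1 1,
    single_sub_single_mem_span_lattice _ _⟩

open Classical in
theorem coe_parallelogramVector (a x y : Additive A) :
    ((parallelogramVector baseVector a x y :
      Submodule.span ℝ (lattice A : Set (EuclideanSpace ℝ A))) : EuclideanSpace ℝ A) =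
      EuclideanSpace.single a.toMul 1 + EuclideanSpace.single (a + x + y).toMul 1 -
        EuclideanSpace.single (a + x).toMul 1 - EuclideanSpace.single (a + y).toMul 1 := by
  simp only [parallelogramVector, baseVector, Submodule.coe_add, Submodule.coe_sub]
  abel

theorem parallelogramVector_mem_lattice (a x y : Additive A) :
    parallelogramVector baseVector a x y ∈ latticeInSpan (lattice A) := by
  classical
  change ((parallelogramVector baseVector a x y :
      Submodule.span ℝ (lattice A : Set (EuclideanSpace ℝ A))) : EuclideanSpace ℝ A) ∈ lattice A
  rw [coe_parallelogramVector]
  refine mem_lattice_iff.2 ⟨Pi.single a.toMul 1 + Pi.single (a + x + y).toMul 1 -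
    Pi.single (a + x).toMul 1 - Pi.single (a + y).toMul 1, ?_, ?_, fun c => ?_⟩
  · simp [Finset.sum_add_distrib, Finset.sum_sub_distrib]
  · have h1 : ∀ b : A, ∏ c, c ^ (Pi.single b 1 : A → ℤ) c = b := fun b => by
      rw [Finset.prod_eq_single b (fun c _ hc => by rw [Pi.single_eq_of_ne hc, zpow_zero])
        (by simp), Pi.single_eq_same, zpow_one]
    simp only [Pi.sub_apply, Pi.add_apply, zpow_sub, zpow_add, Finset.prod_mul_distrib,
      Finset.prod_inv_distrib, h1, toMul_add]
    rw [← div_eq_mul_inv, ← div_eq_mul_inv, div_div, div_eq_one]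
    ac_rfl
  · simp [Pi.single_apply]

open Classical in
theorem norm_single_add_single_sub_single_sub_single {A : Type*} [Fintype A] {p q r s : A}
    (hpq : p ≠ q) (hpr : p ≠ r) (hps : p ≠ s) (hqr : q ≠ r) (hqs : q ≠ s) (hrs : r ≠ s) :
    ‖EuclideanSpace.single p (1 : ℝ) + EuclideanSpace.single q 1 - EuclideanSpace.single r 1 -
      EuclideanSpace.single s 1‖ = 2 := by
  rw [← sq_eq_sq₀ (norm_nonneg _) zero_le_two, ← real_inner_self_eq_norm_sq]
  simp only [inner_add_left, inner_sub_left, EuclideanSpace.inner_single_left]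
  simp [hpq, hpr, hps, hqr, hqs, hrs, hpq.symm, hpr.symm, hps.symm, hqr.symm, hqs.symm, hrs.symm]
  norm_num

theorem norm_parallelogramVector {a x y : Additive A} (hx : x ≠ 0) (hy : y ≠ 0) (hxy : x ≠ y)
    (hxy' : x ≠ -y) : ‖parallelogramVector baseVector a x y‖ = 2 := by
  have h4 : a ≠ a + x + y := by
    rw [add_assoc, ne_comm, ne_eq, add_eq_left]
    exact fun h => hxy' (eq_neg_of_add_eq_zero_left h)
  have hne : ∀ {u v : Additive A}, u ≠ v → u.toMul ≠ v.toMul := fun h h' => h h'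
  rw [← Submodule.norm_coe, coe_parallelogramVector]
  exact norm_single_add_single_sub_single_sub_single (hne h4) (hne (by simpa using hx))
    (hne (by simpa using hy)) (hne (by simpa using hy))
    (hne (by rw [add_right_comm]; simpa using hx)) (hne (by simpa using hxy))

theorem minDist_latticeInSpan_lattice {a x y : Additive A} (hx : x ≠ 0) (hy : y ≠ 0) (hxy : x ≠ y)
    (hxy' : x ≠ -y) : minDist (latticeInSpan (lattice A)) = 2 := by
  have hnorm := norm_parallelogramVector (a := a) hx hy hxy hxy'
  have hne : parallelogramVector baseVector a x y ≠ 0 := norm_ne_zero_iff.1 (by rw [hnorm]; simp)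
  have hmem := parallelogramVector_mem_lattice a x y
  refine le_antisymm ((minDist_le_norm hmem hne).trans_eq hnorm)
    (le_csInf ⟨2, _, hmem, hne, hnorm⟩ ?_)
  rintro _ ⟨z, hz, hz0, rfl⟩
  have hz' : (z : EuclideanSpace ℝ A) ∈ lattice A := hz
  rw [← Submodule.norm_coe]
  exact two_le_norm_of_mem_lattice hz' fun h => hz0 (Subtype.ext h)

theorem inner_baseVector_sub (v : Submodule.span ℝ (lattice A : Set (EuclideanSpace ℝ A)))
    (a b : Additive A) : inner ℝ v (baseVector a - baseVector b) =
      (v : EuclideanSpace ℝ A) a.toMul - (v : EuclideanSpace ℝ A) b.toMul := by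
  classical
  simp [baseVector, Submodule.coe_inner, inner_sub_right, EuclideanSpace.inner_single_right]

theorem sum_inner_baseVector_sub_sq
    (v : Submodule.span ℝ (lattice A : Set (EuclideanSpace ℝ A))) :
    ∑ a, ∑ b, inner ℝ v (baseVector a - baseVector b) ^ 2 =
      2 * Fintype.card (Additive A) * ‖v‖ ^ 2 := by
  have h0 : ∑ a : A, (v : EuclideanSpace ℝ A) a = 0 := sum_eq_zero_of_mem_span_lattice v.2
  have h1 : ∑ a : Additive A, ∑ b : Additive A, inner ℝ v (baseVector a - baseVector b) ^ 2 =
      ∑ a : A, ∑ b : A, ((v : EuclideanSpace ℝ A) a - (v : EuclideanSpace ℝ A) b) ^ 2 := by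
    simp only [inner_baseVector_sub]
    rw [← Equiv.sum_comp Additive.toMul fun a : A =>
      ∑ b : A, ((v : EuclideanSpace ℝ A) a - (v : EuclideanSpace ℝ A) b) ^ 2]
    exact Finset.sum_congr rfl fun a _ => Equiv.sum_comp Additive.toMul fun b : A =>
      ((v : EuclideanSpace ℝ A) a.toMul - (v : EuclideanSpace ℝ A) b) ^ 2
  have h2 : ‖v‖ ^ 2 = ∑ a : A, (v : EuclideanSpace ℝ A) a ^ 2 := by
    rw [← Submodule.norm_coe, EuclideanSpace.real_norm_sq_eq]
  rw [h1, h2]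
  simp only [sub_sq, Finset.sum_add_distrib, Finset.sum_sub_distrib, ← Finset.mul_sum,
    ← Finset.sum_mul, h0, Finset.sum_const, Finset.card_univ, nsmul_eq_mul, Fintype.card_additive]
  ring

theorem exists_eq_sum_smul_baseVector
    (v : Submodule.span ℝ (lattice A : Set (EuclideanSpace ℝ A))) :
    ∃ c : Additive A → ℝ, ∑ a, c a = 0 ∧ (∀ a, |c a| ≤ ‖v‖) ∧ v = ∑ a, c a • baseVector a := by
  classical
  have h0 : ∑ a : A, (v : EuclideanSpace ℝ A) a = 0 := sum_eq_zero_of_mem_span_lattice v.2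
  refine ⟨fun a => (v : EuclideanSpace ℝ A) a.toMul, ?_, fun a => ?_, Subtype.ext ?_⟩
  · exact (Equiv.sum_comp Additive.toMul fun a : A => (v : EuclideanSpace ℝ A) a).trans h0
  · exact PiLp.norm_apply_le (v : EuclideanSpace ℝ A) a.toMul
  · rw [Submodule.coe_sum]
    simp only [baseVector, Submodule.coe_smul]
    rw [Equiv.sum_comp Additive.toMul fun a : A => (v : EuclideanSpace ℝ A) a •
      (EuclideanSpace.single a (1 : ℝ) - EuclideanSpace.single 1 1)]
    simp only [smul_sub, Finset.sum_sub_distrib, ← Finset.sum_smul, h0, zero_smul, sub_zero]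
    ext b
    simp [Pi.single_apply]

end GroupLattice

end AbelianLattice

open AbelianLattice

theorem mainTheorem7 (A : Type*) [CommGroup A] [Fintype A] (hcard : 7 ≤ Fintype.card A)
    (hA : ¬ Nonempty (A ≃* Multiplicative (ZMod 4 × ZMod 2))) :
    AbelianLattice.IsExtreme (AbelianLattice.lattice A) := by
  have hG : ¬ Nonempty (Additive A ≃+ ZMod 4 × ZMod 2) := fun ⟨e⟩ =>
    hA ⟨AddEquiv.toMultiplicativeRight e⟩
  obtain ⟨ε, hε, h⟩ := exists_norm_parallelogramVector_pow_le (G := Additive A)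
    (by rwa [Fintype.card_additive]) hG baseVector
    sum_inner_baseVector_sub_sq exists_eq_sum_smul_baseVector
    fun a x y => norm_parallelogramVector
  refine ⟨inferInstance, ε, hε, fun g hg => ?_⟩
  obtain ⟨a, x, y, hx, hy, hxy, hxy', hle⟩ := h g hg
  have hne : parallelogramVector baseVector a x y ≠ 0 :=
    norm_ne_zero_iff.1 (by rw [norm_parallelogramVector hx hy hxy hxy']; simp)
  have : Nontrivial (Submodule.span ℝ (lattice A : Set (EuclideanSpace ℝ A))) := ⟨_, 0, hne⟩
  have : DiscreteTopology (latticeInSpan (lattice A)) := (isZLattice_latticeInSpan _).1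
  have : IsZLattice ℝ (latticeInSpan (lattice A)) := ⟨(isZLattice_latticeInSpan _).2⟩
  refine packingDensity_map_le g ?_
  rw [minDist_latticeInSpan_lattice (a := a) hx hy hxy hxy']
  refine le_trans (pow_le_pow_left₀ (minDist_nonneg _) ?_ _) hle
  exact minDist_le_norm ⟨_, parallelogramVector_mem_lattice a x y, rfl⟩
    (g.map_ne_zero_iff.2 hne)
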